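/- Let $\mathbb F_q$ be a finite field and let $Y$ be a geometrically integral projective curve over $\mathbb F_q$ with only seminormal singularities, i.e. every local ring $\mathcal O_{Y,P}$ is seminormal: it is reduced, and for all $b,c\in\mathcal O_{Y,P}$ with $b^3=c^2$ there is $a\in\mathcal O_{Y,P}$ with $b=a^2$ and $c=a^3$. Let $u:C\to Y$ be the normalization map. For a scheme $X$ of finite type over $\mathbb F_q$ put $Z_X(t)=\exp\bigl(\sum_{n\ge1}\#X(\mathbb F_{q^n})\,t^n/n\bigr)\in\mathbb Q[[t]]$. Let $C_{[q,2]}$ be the scheme over $\mathbb F_q$ obtained from $C$ by gluing, for every $P\in C(\mathbb F_{q^2})\setminus C(\mathbb F_q)$, the two points $P$ and $F_q(P)$ of its Frobenius orbit to a single $\mathbb F_q$-rational point: its structure sheaf consists of all functions $f$ on $C$ with $f(P)=f(F_q(P))$ for all such $P$ (equivalently, the value of $f$ at every closed point of degree $2$ lies in $\mathbb F_q$). Then $Z_Y(t)/Z_C(t)$ is a polynomial; let $\Delta_Y$ be its degree. If $2\Delta_Y\le \#C(\mathbb F_{q^2})-\#C(\mathbb F_q)$, then $\#Y(\mathbb F_q)\le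 \#C_{[q,2]}(\mathbb F_q)$, and equality holds if and only if $Y$ is isomorphic to $C_{[q,2]}$ over $\mathbb F_q$. -/

import Mathlib

open CategoryTheory TopologicalSpace Opposite AlgebraicGeometry

namespace SingularCurve

noncomputable section

/-- The homomorphism from `k` to the residue field of a `k`-scheme at a point. -/
def constToResidueField {k : Type} [Field k] {X : Scheme.{0}} (π : X ⟶ Spec (.of k)) (x : X) :
    k →+* X.residueField x :=
  ((Scheme.ΓSpecIso (.of k)).inv ≫ π.appTop ≫ X.Γevaluation x).hom

/-- The degree `[κ(x) : k]` of a point of a `k`-scheme (`0` if infinite). For `X` of finite type over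
a finite field `k` with `q` elements, the points of degree `2` are exactly the orbits `{P, F_q(P)}`
of the Frobenius on the set of geometric points in `X(F_{q^2}) \ X(F_q)`. -/
def pointDegree {k : Type} [Field k] {X : Scheme.{0}} (π : X ⟶ Spec (.of k)) (x : X) : ℕ :=
  letI := (constToResidueField π x).toAlgebra
  Module.finrank k (X.residueField x)

/-- The functions on `U` that are compatible with the gluing of `P` with `F_q(P)`, for all `P` in
`X(F_{q^2}) \ X(F_q)`. As `f(F_q(P)) = f(P)^q`, the condition `f(P) = f(F_q(P))` says that the value
of `f` at the point of degree `2` given by the orbit `{P, F_q(P)}` lies in `k = F_q`. -/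
def gluedSections {k : Type} [Field k] {X : Scheme.{0}} (π : X ⟶ Spec (.of k)) (U : X.Opens) :
    Subring Γ(X, U) where
  carrier := {s | ∀ (x : X) (hx : x ∈ U), pointDegree π x = 2 →
    (X.evaluation U x hx).hom s ∈ (constToResidueField π x).range}
  mul_mem' ha hb x hx h := by rw [map_mul]; exact mul_mem (ha x hx h) (hb x hx h)
  one_mem' x hx _ := by rw [map_one]; exact one_mem _
  add_mem' ha hb x hx h := by rw [map_add]; exact add_mem (ha x hx h) (hb x hx h)
  zero_mem' x hx _ := by rw [map_zero]; exact zero_mem _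
  neg_mem' ha x hx h := by rw [map_neg]; exact neg_mem (ha x hx h)

theorem evaluation_map {X : Scheme.{0}} {U V : X.Opens} (i : V ⟶ U) (x : X) (hx : x ∈ V)
    (s : Γ(X, U)) : (X.evaluation V x hx).hom ((X.presheaf.map i.op).hom s) =
      (X.evaluation U x (i.le hx)).hom s := by
  have h : X.presheaf.map i.op ≫ X.evaluation V x hx = X.evaluation U x (i.le hx) := by
    simp only [Scheme.evaluation, TopCat.Presheaf.germ_res_assoc]
  rw [← h]; rfl

theorem map_mem_gluedSections {k : Type} [Field k] {X : Scheme.{0}} (π : X ⟶ Spec (.of k))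
    {U V : X.Opens} (i : V ⟶ U) (s : Γ(X, U)) (hs : s ∈ gluedSections π U) :
    (X.presheaf.map i.op).hom s ∈ gluedSections π V := fun x hx h ↦ by
  rw [evaluation_map]; exact hs x (i.le hx) h

/-- The presheaf of functions compatible with the gluing. -/
def gluedPresheaf {k : Type} [Field k] {X : Scheme.{0}} (π : X ⟶ Spec (.of k)) :
    TopCat.Presheaf CommRingCat.{0} X where
  obj U := .of (gluedSections π U.unop)
  map i := CommRingCat.ofHom <| ((X.presheaf.map i).hom.comp (gluedSections π _).subtype).codRestrict
    _ fun s ↦ map_mem_gluedSections π i.unop s.1 s.2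
  map_id U := by
    ext s
    exact ConcreteCategory.congr_hom (X.presheaf.map_id U) s.1
  map_comp i j := by
    ext s
    exact ConcreteCategory.congr_hom (X.presheaf.map_comp i j) s.1

/-- The inclusion of the functions compatible with the gluing into all functions. -/
def gluedPresheafι {k : Type} [Field k] {X : Scheme.{0}} (π : X ⟶ Spec (.of k)) :
    gluedPresheaf π ⟶ X.presheaf where
  app U := CommRingCat.ofHom (gluedSections π U.unop).subtype
  naturality _ _ _ := rfl

theorem gluedPresheaf_isSheaf {k : Type} [Field k] {X : Scheme.{0}} (π : X ⟶ Spec (.of k)) :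
    (gluedPresheaf π).IsSheaf := by
  rw [TopCat.Presheaf.isSheaf_iff_isSheafUniqueGluing]
  intro ι U sf hsf
  obtain ⟨s, hs, hu⟩ := X.sheaf.existsUnique_gluing U (fun i ↦ (sf i).1)
    (fun i j ↦ congr_arg Subtype.val (hsf i j))
  refine ⟨⟨s, fun x hx h ↦ ?_⟩, fun i ↦ Subtype.ext (hs i), fun t ht ↦ Subtype.ext
    (hu t.1 fun i ↦ congr_arg Subtype.val (ht i))⟩
  obtain ⟨i, hi⟩ := Opens.mem_iSup.mp hx
  have h1 := (sf i).2 x hi h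
  have h2 : (X.presheaf.map (Opens.leSupr U i).op).hom s = (sf i).1 := hs i
  rw [← h2] at h1
  exact (evaluation_map (Opens.leSupr U i) x hi s) ▸ h1

theorem isUnit_gluedSections {k : Type} [Field k] {X : Scheme.{0}} (π : X ⟶ Spec (.of k))
    {U : X.Opens} (s : gluedSections π U) (h : IsUnit s.1) : IsUnit s := by
  obtain ⟨t, ht⟩ := h.exists_right_inv
  refine IsUnit.of_mul_eq_one ⟨t, fun x hx hd ↦ ?_⟩ (Subtype.ext ht)
  obtain ⟨c, hc⟩ := s.2 x hx hd
  have h1 := congr_arg (X.evaluation U x hx).hom ht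
  rw [map_mul, map_one, ← hc] at h1
  exact ⟨c⁻¹, by rw [map_inv₀]; exact (eq_inv_of_mul_eq_one_right h1).symm⟩

theorem isLocalHom_gluedPresheafι {k : Type} [Field k] {X : Scheme.{0}} (π : X ⟶ Spec (.of k))
    (x : X) : IsLocalHom ((TopCat.Presheaf.stalkFunctor CommRingCat x).map (gluedPresheafι π)).hom := by
  refine ⟨fun t ht ↦ ?_⟩
  obtain ⟨U, hx, s, rfl⟩ := (gluedPresheaf π).exists_germ_eq t
  have h1 : IsUnit (X.presheaf.germ U x hx s.1) := by
    convert! ht using 1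
    exact (TopCat.Presheaf.stalkFunctor_map_germ_apply U x hx (gluedPresheafι π) s).symm
  obtain ⟨V, i, hxV, hV⟩ := X.toRingedSpace.isUnit_res_of_isUnit_germ U s.1 x hx h1
  have h2 : IsUnit ((gluedPresheaf π).map i.op s) := isUnit_gluedSections π _ hV
  rw [← (gluedPresheaf π).germ_res_apply i x hxV s]
  exact h2.map ((gluedPresheaf π).germ V x hxV).hom

/-- The gluing of all orbits `{P, F_q(P)}` as a locally ringed space: every such orbit is already a
single point of the scheme `X`, so that the quotient space is `X` itself, and only the structure
sheaf becomes smaller. -/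
def gluedLRS {k : Type} [Field k] {X : Scheme.{0}} (π : X ⟶ Spec (.of k)) :
    LocallyRingedSpace where
  carrier := X.toTopCat
  presheaf := gluedPresheaf π
  IsSheaf := gluedPresheaf_isSheaf π
  isLocalRing x :=
    haveI : IsLocalRing ((TopCat.Presheaf.stalkFunctor CommRingCat x).obj X.presheaf) :=
      X.isLocalRing x
    @RingHom.domain_isLocalRing _ _ _ _ _
      ((TopCat.Presheaf.stalkFunctor CommRingCat x).map (gluedPresheafι π)).hom (isLocalHom_gluedPresheafι π x)

theorem pow_mem_gluedSections {k : Type} [Field k] [Finite k] {X : Scheme.{0}}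
    (π : X ⟶ Spec (.of k)) {U : X.Opens} (s : Γ(X, U)) :
    s ^ (Nat.card k ^ 2 - 1) ∈ gluedSections π U := fun x hx hd ↦ by
  let _ := (constToResidueField π x).toAlgebra
  have hd' : Module.finrank k (X.residueField x) = 2 := hd
  have : Module.Finite k (X.residueField x) := Module.finite_of_finrank_pos (by omega)
  have : Finite (X.residueField x) := Module.finite_of_finite k
  have := Fintype.ofFinite (X.residueField x)
  rw [map_pow]
  generalize (X.evaluation U x hx).hom s = y
  have hq : 1 < Nat.card k := Finite.one_lt_card
  have hc : Nat.card k ^ 2 = Fintype.card (X.residueField x) := by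
    rw [← Nat.card_eq_fintype_card, ← hd', ← Module.natCard_eq_pow_finrank]
  by_cases hy : y = 0
  · rw [hy, zero_pow]
    · exact zero_mem _
    · have : 1 < Nat.card k ^ 2 := Nat.one_lt_pow (by norm_num) hq
      omega
  · rw [hc, FiniteField.pow_card_sub_one_eq_one y hy]
    exact one_mem _


theorem exists_pow_mem_gluedSections {k : Type} [Field k] [Finite k] {X : Scheme.{0}}
    (π : X ⟶ Spec (.of k)) : ∃ n > 0, ∀ (U : X.Opens) (s : Γ(X, U)),
      s ^ n ∈ gluedSections π U := by
  refine ⟨Nat.card k ^ 2 - 1, ?_, fun U s ↦ pow_mem_gluedSections π s⟩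
  have : 1 < Nat.card k ^ 2 := Nat.one_lt_pow (by norm_num) Finite.one_lt_card
  omega

theorem isHomeomorph_comap_gluedSections {k : Type} [Field k] [Finite k] {X : Scheme.{0}}
    (π : X ⟶ Spec (.of k)) (U : X.Opens) :
    IsHomeomorph (PrimeSpectrum.comap (gluedSections π U).subtype) := by
  obtain ⟨n, hn, h⟩ := exists_pow_mem_gluedSections π
  refine PrimeSpectrum.isHomeomorph_comap _ (fun x ↦ ⟨n, hn, ⟨x ^ n, h U x⟩, rfl⟩) ?_
  rw [(RingHom.injective_iff_ker_eq_bot _).mp Subtype.val_injective]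
  exact bot_le

/-- Arbitrarily small basic opens are defined by glued sections. -/
theorem exists_gluedSections_basicOpen {k : Type} [Field k] [Finite k] {X : Scheme.{0}}
    (π : X ⟶ Spec (.of k)) {W V : X.Opens} (hW : IsAffineOpen W) (x : X) (hxW : x ∈ W)
    (hxV : x ∈ V) : ∃ a ∈ gluedSections π W, X.basicOpen a ≤ V ∧ x ∈ X.basicOpen a := by
  obtain ⟨n, hn, h⟩ := exists_pow_mem_gluedSections π
  obtain ⟨a, ha, hxa⟩ := hW.exists_basicOpen_le ⟨x, hxV⟩ hxW
  refine ⟨a ^ n, h W a, ?_, ?_⟩ <;> rwa [Scheme.basicOpen_pow _ _ hn]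

theorem exists_mul_eq_of_gluedSections {k : Type} [Field k] {X : Scheme.{0}}
    (π : X ⟶ Spec (.of k)) {W : X.Opens} (hW : IsAffineOpen W) (a : Γ(X, W))
    (ha : a ∈ gluedSections π W) (s : Γ(X, X.basicOpen a))
    (hs : s ∈ gluedSections π (X.basicOpen a)) :
    ∃ b ∈ gluedSections π W, ∃ n : ℕ,
      (X.presheaf.map (homOfLE (X.basicOpen_le a)).op).hom b =
      (X.presheaf.map (homOfLE (X.basicOpen_le a)).op).hom (a ^ n) * s := by
  have := hW.isLocalization_basicOpen a
  obtain ⟨n, b, hb⟩ := IsLocalization.Away.surj a s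
  refine ⟨b * a, ?_, n + 1, ?_⟩
  · intro x hx hd
    by_cases hxa : x ∈ X.basicOpen a
    · have h1 := congr_arg (X.evaluation _ x hxa).hom hb
      have h2 : algebraMap Γ(X, W) Γ(X, X.basicOpen a) =
        (X.presheaf.map (homOfLE (X.basicOpen_le a)).op).hom := rfl
      rw [map_mul, ← map_pow, h2, evaluation_map, evaluation_map] at h1
      rw [map_mul, ← h1, map_pow]
      exact mul_mem (mul_mem (hs x hxa hd) (pow_mem (ha x hx hd) n)) (ha x hx hd)
    · have h0 : (X.evaluation W x hx).hom a = 0 :=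
        (X.evaluation_eq_zero_iff_notMem_basicOpen x hx a).mpr hxa
      rw [map_mul, h0, mul_zero]
      exact zero_mem _
  · have h2 : algebraMap Γ(X, W) Γ(X, X.basicOpen a) =
        (X.presheaf.map (homOfLE (X.basicOpen_le a)).op).hom := rfl
    rw [h2] at hb
    rw [map_mul, ← hb, map_pow]
    ring

theorem exists_pow_mul_eq {X : Scheme.{0}}
    {W : X.Opens} (hW : IsAffineOpen W) (a x y : Γ(X, W))
    (h : (X.presheaf.map (homOfLE (X.basicOpen_le a)).op).hom x =
      (X.presheaf.map (homOfLE (X.basicOpen_le a)).op).hom y) :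
    ∃ n : ℕ, a ^ n * x = a ^ n * y := by
  have := hW.isLocalization_basicOpen a
  obtain ⟨⟨_, n, rfl⟩, hc⟩ := (IsLocalization.eq_iff_exists (Submonoid.powers a) _).mp h
  exact ⟨n, hc⟩


/-- The glued space over an open subset. -/
def gluedOn {k : Type} [Field k] {X : Scheme.{0}} (π : X ⟶ Spec (.of k)) (U : X.Opens) :
    LocallyRingedSpace :=
  (gluedLRS π).restrict (Opens.isOpenEmbedding (X := X.toTopCat) U)


/-- An open subset of an open subset `U`, as an open subset of the whole space. -/
abbrev gluedOnImage {k : Type} [Field k] {X : Scheme.{0}} (π : X ⟶ Spec (.of k)) (U : X.Opens)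
    (V : Opens (gluedOn π U)) : X.Opens :=
  (Opens.isOpenEmbedding (X := X.toTopCat) U).functor.obj V

theorem isUnit_germ_gluedOn_iff {k : Type} [Field k] {X : Scheme.{0}} (π : X ⟶ Spec (.of k))
    (U : X.Opens) (z : gluedOn π U) (r : gluedSections π (gluedOnImage π U ⊤)) :
    IsUnit ((gluedOn π U).presheaf.Γgerm z r) ↔ z.1 ∈ X.basicOpen r.1 := by
  have hz : z.1 ∈ gluedOnImage π U ⊤ := ⟨z, trivial, rfl⟩
  rw [X.mem_basicOpen _ _ hz]
  constructor
  · intro h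
    obtain ⟨V, i, hzV, hV⟩ := (gluedOn π U).toRingedSpace.isUnit_res_of_isUnit_germ ⊤ r z trivial h
    have h1 := hV.map (gluedSections π _).subtype
    have hz' : z.1 ∈ gluedOnImage π U V := ⟨z, hzV, rfl⟩
    have h2 := h1.map (X.presheaf.germ _ z.1 hz').hom
    exact (congrArg IsUnit (X.presheaf.germ_res_apply
      ((Opens.isOpenEmbedding (X := X.toTopCat) U).functor.map i) z.1 hz' r.1)).mp h2
  · intro h
    obtain ⟨V, i, hzV, hV⟩ := X.toRingedSpace.isUnit_res_of_isUnit_germ _ r.1 z.1 hz h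
    let V' : Opens (gluedOn π U) := (Opens.map (Opens.inclusion' (X := X.toTopCat) U)).obj V
    have hle : gluedOnImage π U V' ≤ V := by
      rintro _ ⟨y, hy, rfl⟩; exact hy
    have h1 := hV.map (X.presheaf.map (homOfLE hle).op).hom
    have h2 : IsUnit ((gluedOn π U).presheaf.map (homOfLE (le_top : V' ≤ ⊤)).op r) := by
      refine isUnit_gluedSections π _ ?_
      convert! h1 using 1
      exact ConcreteCategory.congr_hom (X.presheaf.map_comp i.op (homOfLE hle).op) r.1
    have h3 := h2.map ((gluedOn π U).presheaf.germ V' z hzV).hom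
    have h4 := (gluedOn π U).presheaf.germ_res_apply (homOfLE (le_top : V' ≤ ⊤)) z hzV r
    exact (congrArg IsUnit h4).mp h3

theorem isAffineOpen_gluedOnImage {k : Type} [Field k] {X : Scheme.{0}} (π : X ⟶ Spec (.of k))
    (U : X.Opens) (hU : IsAffineOpen U) : IsAffineOpen (gluedOnImage π U ⊤) := by
  convert! hU
  ext x
  exact ⟨fun ⟨y, _, hy⟩ ↦ hy ▸ y.2, fun hx ↦ ⟨⟨x, hx⟩, trivial, rfl⟩⟩

theorem mem_gluedOnImage_top {k : Type} [Field k] {X : Scheme.{0}} (π : X ⟶ Spec (.of k))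
    (U : X.Opens) (z : gluedOn π U) : z.1 ∈ gluedOnImage π U ⊤ := ⟨z, trivial, rfl⟩

theorem gluedOn_toΓSpecFun {k : Type} [Field k] {X : Scheme.{0}} (π : X ⟶ Spec (.of k))
    (U : X.Opens) (hW : IsAffineOpen (gluedOnImage π U ⊤)) (z : gluedOn π U) :
    (gluedOn π U).toΓSpecFun z =
      PrimeSpectrum.comap (gluedSections π (gluedOnImage π U ⊤)).subtype
        (hW.primeIdealOf ⟨z.1, mem_gluedOnImage_top π U z⟩) := by
  have key (r : gluedSections π (gluedOnImage π U ⊤)) :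
      r ∉ ((gluedOn π U).toΓSpecFun z).asIdeal ↔
      r.1 ∉ (hW.primeIdealOf ⟨z.1, mem_gluedOnImage_top π U z⟩).asIdeal := by
    rw [hW.primeIdealOf_eq_map_closedPoint]
    refine ((gluedOn π U).notMem_prime_iff_unit_in_stalk r z).trans
      ((isUnit_germ_gluedOn_iff π U z r).trans ?_)
    rw [X.mem_basicOpen _ _ (mem_gluedOnImage_top π U z)]
    exact not_not.symm
  refine PrimeSpectrum.ext (Ideal.ext fun r ↦ not_iff_not.mp (key r))

theorem isHomeomorph_gluedOn_toΓSpec {k : Type} [Field k] [Finite k] {X : Scheme.{0}}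
    (π : X ⟶ Spec (.of k)) (U : X.Opens) (hW : IsAffineOpen (gluedOnImage π U ⊤)) :
    IsHomeomorph (gluedOn π U).toΓSpecFun := by
  have h1 : IsHomeomorph hW.primeIdealOf :=
    (TopCat.isIso_iff_isHomeomorph hW.isoSpec.hom.base).mp inferInstance
  have h2 : (U : Set X) = (gluedOnImage π U ⊤ : X.Opens) := by
    ext x
    exact ⟨fun hx ↦ ⟨⟨x, hx⟩, trivial, rfl⟩, fun ⟨y, _, hy⟩ ↦ hy ▸ y.2⟩
  have h3 := ((isHomeomorph_comap_gluedSections π _).comp h1).comp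
    (Homeomorph.setCongr h2).isHomeomorph
  convert! h3 using 1
  funext z
  exact gluedOn_toΓSpecFun π U hW z


theorem isIso_stalkMap_toΓSpec (Z : LocallyRingedSpace.{0}) (z : Z)
    (h : @IsLocalization (LocallyRingedSpace.Γ.obj (op Z)) _ (Z.toΓSpecFun z).asIdeal.primeCompl
      (Z.presheaf.stalk z) _ (RingHom.toAlgebra (Z.presheaf.Γgerm z).hom)) :
    IsIso (Z.toΓSpec.stalkMap z) := by
  rw [ConcreteCategory.isIso_iff_bijective]
  exact @IsLocalization.bijective (LocallyRingedSpace.Γ.obj (op Z)) _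
    (Z.toΓSpecFun z).asIdeal.primeCompl
    ((Spec.structureSheaf (LocallyRingedSpace.Γ.obj (op Z))).presheaf.stalk (Z.toΓSpecFun z)) _
    _ (StructureSheaf.IsLocalization.to_stalk _ _)
    (Z.presheaf.stalk z) _ (RingHom.toAlgebra (Z.presheaf.Γgerm z).hom) h
    (Z.toΓSpec.stalkMap z).hom
    (congrArg CommRingCat.Hom.hom (Z.toStalk_stalkMap_toΓSpec z))

theorem gluedOn_germ_congr {k : Type} [Field k] {X : Scheme.{0}}
    (π : X ⟶ Spec (.of k)) (U : X.Opens) (z : gluedOn π U) (D : X.Opens) (hz : z.1 ∈ D)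
    (V₁ V₂ : Opens (gluedOn π U)) (h₁ : z ∈ V₁) (h₂ : z ∈ V₂)
    (s₁ : gluedSections π (gluedOnImage π U V₁)) (s₂ : gluedSections π (gluedOnImage π U V₂))
    (hD₁ : D ≤ gluedOnImage π U V₁) (hD₂ : D ≤ gluedOnImage π U V₂)
    (h : (X.presheaf.map (homOfLE hD₁).op).hom s₁.1 = (X.presheaf.map (homOfLE hD₂).op).hom s₂.1) :
    (gluedOn π U).presheaf.germ V₁ z h₁ s₁ = (gluedOn π U).presheaf.germ V₂ z h₂ s₂ := by
  let D' : Opens (gluedOn π U) := (Opens.map (Opens.inclusion' (X := X.toTopCat) U)).obj D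
  have hle : gluedOnImage π U D' ≤ D := by
    rintro _ ⟨y, hy, rfl⟩; exact hy
  have hsub (V : Opens (gluedOn π U)) (hV : D ≤ gluedOnImage π U V) : D' ≤ V := fun y hy ↦ by
    obtain ⟨w, hw, hwy⟩ := hV (show y.1 ∈ D from hy)
    exact (Subtype.ext hwy : w = y) ▸ hw
  refine TopCat.Presheaf.germ_ext (gluedOn π U).presheaf D' hz (homOfLE (hsub V₁ hD₁))
    (homOfLE (hsub V₂ hD₂)) (Subtype.ext ?_)
  have e₁ := ConcreteCategory.congr_hom
    (X.presheaf.map_comp (homOfLE hD₁).op (homOfLE hle).op) s₁.1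
  have e₂ := ConcreteCategory.congr_hom
    (X.presheaf.map_comp (homOfLE hD₂).op (homOfLE hle).op) s₂.1
  refine e₁.trans (Eq.trans ?_ e₂.symm)
  exact congrArg (X.presheaf.map (homOfLE hle).op).hom h

theorem isLocalization_gluedOn {k : Type} [Field k] [Finite k] {X : Scheme.{0}}
    (π : X ⟶ Spec (.of k)) (U : X.Opens) (hW : IsAffineOpen (gluedOnImage π U ⊤))
    (z : gluedOn π U) :
    @IsLocalization (LocallyRingedSpace.Γ.obj (op (gluedOn π U))) _
      ((gluedOn π U).toΓSpecFun z).asIdeal.primeCompl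
      ((gluedOn π U).presheaf.stalk z) _
      (RingHom.toAlgebra ((gluedOn π U).presheaf.Γgerm z).hom) := by
  have hmem (a : gluedSections π (gluedOnImage π U ⊤)) (ha : z.1 ∈ X.basicOpen a.1) :
      a ∈ ((gluedOn π U).toΓSpecFun z).asIdeal.primeCompl :=
    ((gluedOn π U).notMem_prime_iff_unit_in_stalk a z).mpr
      ((isUnit_germ_gluedOn_iff π U z a).mpr ha)
  refine (@isLocalization_iff _ _ _ _ _
    (RingHom.toAlgebra ((gluedOn π U).presheaf.Γgerm z).hom)).mpr
    ⟨fun r ↦ ?_, fun t ↦ ?_, fun {x y} h ↦ ?_⟩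
  · exact ((gluedOn π U).notMem_prime_iff_unit_in_stalk r.1 z).mp r.2
  · obtain ⟨V, hzV, s, rfl⟩ := (gluedOn π U).presheaf.exists_germ_eq t
    obtain ⟨a, ha, haV, hza⟩ := exists_gluedSections_basicOpen π (V := gluedOnImage π U V) hW z.1
      (mem_gluedOnImage_top π U z) ⟨z, hzV, rfl⟩
    obtain ⟨b, hb, n, hn⟩ := exists_mul_eq_of_gluedSections π hW a ha
      ((X.presheaf.map (homOfLE haV).op).hom s.1) (map_mem_gluedSections π _ _ s.2)
    let a' : gluedSections π (gluedOnImage π U ⊤) := ⟨a, ha⟩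
    refine ⟨(⟨b, hb⟩, ⟨a' ^ n, pow_mem (hmem a' hza) n⟩), ?_⟩
    let i : V ⟶ ⊤ := homOfLE le_top
    have e1 : (gluedOn π U).presheaf.Γgerm z (a' ^ n) = (gluedOn π U).presheaf.germ V z hzV
        ((gluedOn π U).presheaf.map i.op (a' ^ n)) :=
      ((gluedOn π U).presheaf.germ_res_apply i z hzV (a' ^ n)).symm
    change (gluedOn π U).presheaf.germ V z hzV s * (gluedOn π U).presheaf.Γgerm z (a' ^ n) =
      (gluedOn π U).presheaf.Γgerm z _
    rw [e1, ← map_mul]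
    refine gluedOn_germ_congr π U z (X.basicOpen a) hza V ⊤ hzV trivial _ _ haV
      (X.basicOpen_le a) ?_
    refine Eq.trans ?_ hn.symm
    have e2 := ConcreteCategory.congr_hom (X.presheaf.map_comp
      ((Opens.isOpenEmbedding (X := X.toTopCat) U).functor.map i).op (homOfLE haV).op) (a ^ n)
    refine (map_mul (X.presheaf.map (homOfLE haV).op).hom s.1 _).trans ?_
    rw [mul_comm]
    exact congrArg (· * _) e2.symm
  · have h' : (gluedOn π U).presheaf.germ ⊤ z trivial x =
        (gluedOn π U).presheaf.germ ⊤ z trivial y := h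
    obtain ⟨V, hzV, i₁, i₂, hxy⟩ := (gluedOn π U).presheaf.germ_eq
      (U := ⊤) (V := ⊤) z trivial trivial x y h'
    obtain ⟨a, ha, haV, hza⟩ := exists_gluedSections_basicOpen π (V := gluedOnImage π U V) hW z.1
      (mem_gluedOnImage_top π U z) ⟨z, hzV, rfl⟩
    let x' : gluedSections π (gluedOnImage π U ⊤) := x
    let y' : gluedSections π (gluedOnImage π U ⊤) := y
    obtain ⟨n, hn⟩ := exists_pow_mul_eq hW a x'.1 y'.1 (by
      have e1 := ConcreteCategory.congr_hom (X.presheaf.map_comp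
        ((Opens.isOpenEmbedding (X := X.toTopCat) U).functor.map i₁).op (homOfLE haV).op) x'.1
      have e2 := ConcreteCategory.congr_hom (X.presheaf.map_comp
        ((Opens.isOpenEmbedding (X := X.toTopCat) U).functor.map i₂).op (homOfLE haV).op) y'.1
      refine e1.trans (Eq.trans ?_ e2.symm)
      exact congrArg (X.presheaf.map (homOfLE haV).op).hom (congrArg Subtype.val hxy))
    let a' : gluedSections π (gluedOnImage π U ⊤) := ⟨a, ha⟩
    exact ⟨⟨a' ^ n, pow_mem (hmem a' hza) n⟩, Subtype.ext hn⟩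

theorem isIso_gluedOn_toΓSpec {k : Type} [Field k] [Finite k] {X : Scheme.{0}}
    (π : X ⟶ Spec (.of k)) (U : X.Opens) (hU : IsAffineOpen U) :
    IsIso (gluedOn π U).toΓSpec := by
  have hW := isAffineOpen_gluedOnImage π U hU
  have hh := isHomeomorph_gluedOn_toΓSpec π U hW
  have h1 (z) : IsIso ((gluedOn π U).toΓSpec.stalkMap z) :=
    isIso_stalkMap_toΓSpec _ z (isLocalization_gluedOn π U hW z)
  have : IsIso (gluedOn π U).toΓSpec.base := (TopCat.isIso_iff_isHomeomorph _).mpr hh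
  have := LocallyRingedSpace.IsOpenImmersion.of_stalk_iso (gluedOn π U).toΓSpec
    hh.isOpenEmbedding
  exact LocallyRingedSpace.IsOpenImmersion.to_iso _

/-- The scheme `X_{[q,2]}` for a scheme `X` over the field `k` with `q` elements: it is obtained from
`X` by gluing, for every `P` in `X(F_{q^2}) \ X(F_q)`, the points of the Frobenius orbit
`{P, F_q(P)}` to one point with residue field `F_q`, with the largest possible structure sheaf,
i.e. all functions on `X` that are constant on each of these orbits. -/
def gluedScheme {k : Type} [Field k] [Finite k] {X : Scheme.{0}} (π : X ⟶ Spec (.of k)) :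
    Scheme.{0} where
  __ := gluedLRS π
  local_affine x := by
    obtain ⟨_, ⟨U, hU, rfl⟩, hxU, -⟩ :=
      X.isBasis_affineOpens.exists_subset_of_mem_open (Set.mem_univ x) isOpen_univ
    have := isIso_gluedOn_toΓSpec π U hU
    exact ⟨⟨U, hxU⟩, _, ⟨@asIso _ _ _ _ (gluedOn π U).toΓSpec this⟩⟩

/-- The structure morphism `X_{[q,2]} ⟶ Spec k`. -/
def gluedStr {k : Type} [Field k] [Finite k] {X : Scheme.{0}} (π : X ⟶ Spec (.of k)) :
    gluedScheme π ⟶ Spec (.of k) :=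
  Scheme.toSpecΓ _ ≫ Spec.map (CommRingCat.ofHom
    (((Scheme.ΓSpecIso (.of k)).inv ≫ π.appTop).hom.codRestrict (gluedSections π ⊤)
      fun c _ _ _ ↦ ⟨c, rfl⟩))

/-- The `K`-points of a `k`-scheme. -/
def KPoints {k : Type} [Field k] {X : Scheme.{0}} (π : X ⟶ Spec (.of k)) (K : Type) [Field K]
    [Algebra k K] : Type :=
  {x : Spec (.of K) ⟶ X // x ≫ π = Spec.map (CommRingCat.ofHom (algebraMap k K))}

/-- The number of `K`-points of a `k`-scheme. -/
def numPoints {k : Type} [Field k] {X : Scheme.{0}} (π : X ⟶ Spec (.of k)) (K : Type) [Field K]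
    [Algebra k K] : ℕ :=
  Nat.card (KPoints π K)

/-- The power series `∑_{n ≥ 1} #X(F_{q^n}) tⁿ / n`. -/
def logZeta (p : ℕ) [Fact p.Prime] {k : Type} [Field k] [Finite k] [CharP k p] {X : Scheme.{0}}
    (π : X ⟶ Spec (.of k)) : PowerSeries ℚ :=
  PowerSeries.mk fun n ↦ match n with
    | 0 => 0
    | m + 1 => (numPoints π (FiniteField.Extension k p (m + 1)) : ℚ) / ((m : ℚ) + 1)

/-- The zeta function `Z_X(t) = exp (∑_{n ≥ 1} #X(F_{q^n}) tⁿ / n)`. -/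
def zeta (p : ℕ) [Fact p.Prime] {k : Type} [Field k] [Finite k] [CharP k p] {X : Scheme.{0}}
    (π : X ⟶ Spec (.of k)) : PowerSeries ℚ :=
  PowerSeries.subst (logZeta p π) (PowerSeries.exp ℚ)

/-- Projective space `ℙⁿ` over `k`. -/
def projSpace (k : Type) [Field k] (n : ℕ) : Scheme.{0} :=
  letI := MvPolynomial.gradedAlgebra (σ := Fin (n + 1)) (R := k)
  Proj (MvPolynomial.homogeneousSubmodule (Fin (n + 1)) k)

/-- The structure morphism of projective space. -/
def projSpaceStr (k : Type) [Field k] (n : ℕ) : projSpace k n ⟶ Spec (.of k) :=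
  letI := MvPolynomial.gradedAlgebra (σ := Fin (n + 1)) (R := k)
  Proj.toSpecZero (MvPolynomial.homogeneousSubmodule (Fin (n + 1)) k) ≫
    Spec.map (CommRingCat.ofHom
      (algebraMap k (MvPolynomial.homogeneousSubmodule (Fin (n + 1)) k 0)))

/-- A geometrically integral projective curve over a field `k`. -/
structure IsProjectiveCurve {k : Type} [Field k] {Y : Scheme.{0}} (π : Y ⟶ Spec (.of k)) :
    Prop where
  geometricallyIntegral : GeometricallyIntegral π
  projective : ∃ (n : ℕ) (i : Y ⟶ projSpace k n), IsClosedImmersion i ∧ i ≫ projSpaceStr k n = π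
  dim_eq_one : topologicalKrullDim Y = 1

/-- Seminormal rings: reduced, and whenever `b ^ 3 = c ^ 2` there is `a` with
`b = a ^ 2`, `c = a ^ 3`. -/
structure IsSeminormalRing (R : Type) [CommRing R] : Prop where
  isReduced : IsReduced R
  exists_eq (b c : R) : b ^ 3 = c ^ 2 → ∃ a : R, a ^ 2 = b ∧ a ^ 3 = c

/-- A scheme with only seminormal singularities: all its local rings are seminormal. -/
def IsSeminormal (Y : Scheme.{0}) : Prop :=
  ∀ y : Y, IsSeminormalRing (Y.presheaf.stalk y)

/-- `u` is the normalization of the integral scheme `Y`: a finite birational morphism from a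
normal integral scheme. -/
structure IsNormalization {C Y : Scheme.{0}} (u : C ⟶ Y) : Prop where
  isIntegral : IsIntegral C
  isIntegrallyClosed (x : C) : IsIntegrallyClosed (C.presheaf.stalk x)
  isFinite : IsFinite u
  birational : ∃ V : Y.Opens, (V : Set Y).Nonempty ∧ IsIso (u ∣_ V)

end

end SingularCurve

/-! The map `u` is an isomorphism over a dense open `V`, and since `Y` is a curve the complement `S`
of `V` is a finite set of closed points. Put `T = u⁻¹(S)`, also finite. Off `S` and `T` points
correspond with equal degrees, so the point counts over all extensions differ only by contributions
of `S` and `T`, and exponentiating gives `Z_Y / Z_C = ∏_{c ∈ T} (1 - t^{deg c}) / ∏_{y ∈ S} (1 -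
t^{deg y})`. Each `y` in `S` lies under some `c` with `deg y ∣ deg c`, so this is a polynomial, of
degree `Δ = ∑_T deg c - ∑_S deg y`.

The inequality is local on `S` (`sum_fiber_ge`): one has `[deg y = 1] + deg y ≤ ∑_{c ↦ y} (deg c +
[deg c = 1])`, with equality only if the fibre is a single `c` and either `deg c = deg y` or `(deg
y, deg c) = (1, 2)`. Summing gives `#Y(k) ≤ #C(k) + Δ`. If `B₂` is the number of points of degree 2
on `C`, then `#C(k²) - #C(k) = 2 B₂`, so the hypothesis reads `Δ ≤ B₂`, while `#C_{[q,2]}(k) = #C(k)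
+ B₂` (`numPoints_gluedStr`).

If equality holds, `u` is bijective, every point of degree 2 lies over a rational point, and all
other residue degrees are 1 (`count_le_and_of_eq`). Hence `u` factors through a homeomorphism
`C_{[q,2]} ⟶ Y` (`gluedDesc`). Seminormality makes the conductor radical, so a germ on `C` comes
from `Y` as soon as its value does (`germ_mem_range_stalkMap`). The stalks of `C_{[q,2]}` and `Y`
therefore agree (`isIso_gluedDesc`). -/

namespace SingularCurve

/-! ### Exponentials of formal power series -/

section PowerSeriesExp

open PowerSeries

/-- The quotient `F * G⁻¹` has derivative 0 and constant coefficient 1. This uniqueness for the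
equation `F' = a F` yields the exponential identities below without comparing coefficients of `exp`.
-/
theorem powerSeries_eq_of_derivative_eq_mul {F G a : ℚ⟦X⟧} (hF : derivative ℚ F = a * F)
    (hG : derivative ℚ G = a * G) (hF0 : constantCoeff F = 1) (hG0 : constantCoeff G = 1) :
    F = G := by
  have hG1 : constantCoeff G ≠ 0 := by rw [hG0]; exact one_ne_zero
  have hinv : G * G⁻¹ = 1 := PowerSeries.mul_inv_cancel _ hG1
  have h : F * G⁻¹ = 1 := by
    refine derivative.ext ?_ ?_
    · rw [Derivation.leibniz, derivative_inv', hF, hG, derivative_one]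
      simp only [smul_eq_mul]
      linear_combination (-F * G⁻¹ * a) * hinv
    · rw [map_mul, hF0, constantCoeff_inv, hG0]; simp
  linear_combination G * h - F * hinv

theorem constantCoeff_exp_subst {f : ℚ⟦X⟧} (hf : constantCoeff f = 0) :
    constantCoeff ((exp ℚ).subst f) = 1 := by
  have hs := HasSubst.of_constantCoeff_zero' hf
  have h1 : (exp ℚ) = (exp ℚ - 1) + 1 := by ring
  have h2 : (1 : ℚ⟦X⟧).subst f = 1 := by
    rw [← coe_substAlgHom hs, map_one]
  rw [h1, subst_add hs, h2, map_add, map_one]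
  have := constantCoeff_subst_eq_zero (R := ℚ) (a := f) hf (exp ℚ - 1) (by simp)
  rw [show constantCoeff ((exp ℚ - 1).subst f) = 0 from this, zero_add]

theorem derivative_exp_subst {f : ℚ⟦X⟧} (hf : constantCoeff f = 0) :
    derivative ℚ ((exp ℚ).subst f) = derivative ℚ f * (exp ℚ).subst f := by
  rw [derivative_subst (HasSubst.of_constantCoeff_zero' hf), derivative_exp, mul_comm]

theorem exp_subst_add {f g : ℚ⟦X⟧} (hf : constantCoeff f = 0) (hg : constantCoeff g = 0) :
    (exp ℚ).subst (f + g) = (exp ℚ).subst f * (exp ℚ).subst g := by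
  have hfg : constantCoeff (f + g) = 0 := by rw [map_add, hf, hg, add_zero]
  refine powerSeries_eq_of_derivative_eq_mul (derivative_exp_subst hfg) ?_
    (constantCoeff_exp_subst hfg) ?_
  · rw [Derivation.leibniz, derivative_exp_subst hf, derivative_exp_subst hg, map_add]
    simp only [smul_eq_mul]; ring
  · rw [map_mul, constantCoeff_exp_subst hf, constantCoeff_exp_subst hg, one_mul]

theorem exp_subst_sum {ι : Type*} (s : Finset ι) (f : ι → ℚ⟦X⟧)
    (hf : ∀ i ∈ s, constantCoeff (f i) = 0) :
    (exp ℚ).subst (∑ i ∈ s, f i) = ∏ i ∈ s, (exp ℚ).subst (f i) := by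
  classical
  induction s using Finset.induction_on with
  | empty =>
    rw [Finset.sum_empty, Finset.prod_empty]
    refine powerSeries_eq_of_derivative_eq_mul (derivative_exp_subst (map_zero _)) ?_
      (constantCoeff_exp_subst (map_zero _)) (map_one _)
    rw [derivative_one, map_zero, zero_mul]
  | insert i s hi ih =>
    have h1 : ∀ i ∈ s, constantCoeff (f i) = 0 := fun j hj ↦ hf j (Finset.mem_insert_of_mem hj)
    rw [Finset.sum_insert hi, Finset.prod_insert hi,
      exp_subst_add (hf i (Finset.mem_insert_self _ _))
        (by rw [map_sum]; exact Finset.sum_eq_zero h1), ih h1]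

/-- The power series `- log (1 - t ^ d) = ∑_{d ∣ n} d tⁿ / n`. -/
noncomputable def negLogOneSubPow (d : ℕ) : ℚ⟦X⟧ :=
  mk fun n ↦ if d ∣ n then (d : ℚ) / n else 0

theorem constantCoeff_negLogOneSubPow (d : ℕ) : constantCoeff (negLogOneSubPow d) = 0 := by
  rw [← coeff_zero_eq_constantCoeff_apply, negLogOneSubPow, coeff_mk]; simp

theorem exp_subst_negLogOneSubPow {d : ℕ} (hd : 0 < d) :
    (exp ℚ).subst (negLogOneSubPow d) * (1 - X ^ d) = 1 := by
  have h0 := constantCoeff_negLogOneSubPow d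
  -- With this, the product rule gives the product in question derivative 0, so it solves the same
  -- equation as 1, with `a = 0`.
  have key : derivative ℚ (negLogOneSubPow d) * (1 - X ^ d) = (d : ℚ⟦X⟧) * X ^ (d - 1) := by
    have hc (n : ℕ) : coeff n (derivative ℚ (negLogOneSubPow d)) =
        if d ∣ n + 1 then (d : ℚ) else 0 := by
      rw [coeff_derivative, negLogOneSubPow, coeff_mk]
      split_ifs
      · push_cast; field_simp
      · rw [zero_mul]
    ext n
    rw [mul_sub, mul_one, map_sub, coeff_mul_X_pow', hc, ← nsmul_eq_mul, map_nsmul, coeff_X_pow]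
    by_cases h : d ≤ n
    · have h2 : d ∣ n - d + 1 ↔ d ∣ n + 1 := by
        rw [show n + 1 = (n - d + 1) + d by omega, Nat.dvd_add_self_right]
      simp [h, hc, h2, show n ≠ d - 1 by omega]
    · rw [if_neg h]
      by_cases h2 : n = d - 1
      · have h3 : n + 1 = d := by omega
        simp [h2, show d - 1 + 1 = d by omega]
      · have h3 : ¬ d ∣ n + 1 := fun hdv ↦ by
          have := Nat.le_of_dvd (by omega) hdv
          omega
        simp [h2, h3]
  refine powerSeries_eq_of_derivative_eq_mul (a := 0) ?_ (by rw [derivative_one, zero_mul]) ?_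
    (map_one _)
  · rw [Derivation.leibniz, derivative_exp_subst h0, map_sub, derivative_one, derivative_pow,
      derivative_X]
    simp only [smul_eq_mul]
    linear_combination (exp ℚ).subst (negLogOneSubPow d) * key
  · rw [map_mul, constantCoeff_exp_subst h0]
    simp [hd.ne']

theorem exp_subst_mul_prod {ι κ : Type*} {f g : ℚ⟦X⟧} (hf : constantCoeff f = 0)
    (hg : constantCoeff g = 0) (s : Finset ι) (t : Finset κ) {a : ι → ℕ} {b : κ → ℕ}
    (ha : ∀ i ∈ s, 0 < a i) (hb : ∀ i ∈ t, 0 < b i)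
    (h : f + ∑ i ∈ t, negLogOneSubPow (b i) = g + ∑ i ∈ s, negLogOneSubPow (a i)) :
    (exp ℚ).subst f * ∏ i ∈ s, (1 - X ^ a i) = (exp ℚ).subst g * ∏ i ∈ t, (1 - X ^ b i) := by
  have h1 := congrArg (fun x ↦ (exp ℚ).subst x) h
  have hL (d : ℕ) := constantCoeff_negLogOneSubPow d
  rw [exp_subst_add hf (by rw [map_sum]; exact Finset.sum_eq_zero fun i _ ↦ hL _),
    exp_subst_add hg (by rw [map_sum]; exact Finset.sum_eq_zero fun i _ ↦ hL _),
    exp_subst_sum _ _ fun i _ ↦ hL _, exp_subst_sum _ _ fun i _ ↦ hL _] at h1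
  have hs : (∏ i ∈ s, (exp ℚ).subst (negLogOneSubPow (a i))) * ∏ i ∈ s, (1 - X ^ a i) = 1 := by
    rw [← Finset.prod_mul_distrib]
    exact Finset.prod_eq_one fun i hi ↦ exp_subst_negLogOneSubPow (ha i hi)
  have ht : (∏ i ∈ t, (exp ℚ).subst (negLogOneSubPow (b i))) * ∏ i ∈ t, (1 - X ^ b i) = 1 := by
    rw [← Finset.prod_mul_distrib]
    exact Finset.prod_eq_one fun i hi ↦ exp_subst_negLogOneSubPow (hb i hi)
  linear_combination (∏ i ∈ s, (1 - X ^ a i)) * (∏ i ∈ t, (1 - X ^ b i)) * h1 -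
    (exp ℚ).subst f * (∏ i ∈ s, (1 - X ^ a i)) * ht +
    (exp ℚ).subst g * (∏ i ∈ t, (1 - X ^ b i)) * hs

end PowerSeriesExp

/-! ### Products of the polynomials `1 - X ^ d` -/

section Polynomials

open Polynomial

theorem natDegree_one_sub_X_pow (d : ℕ) : (1 - X ^ d : ℚ[X]).natDegree = d := by
  rw [← natDegree_neg, neg_sub]
  exact natDegree_X_pow_sub_C (r := (1 : ℚ))

theorem one_sub_X_pow_ne_zero {d : ℕ} (hd : 0 < d) : (1 - X ^ d : ℚ[X]) ≠ 0 := fun h ↦ by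
  have := natDegree_one_sub_X_pow d
  rw [h, natDegree_zero] at this
  omega

theorem one_sub_X_pow_dvd {d e : ℕ} (h : d ∣ e) : (1 - X ^ d : ℚ[X]) ∣ 1 - X ^ e := by
  obtain ⟨m, rfl⟩ := h
  rw [pow_mul]
  exact one_sub_dvd_one_sub_pow _ _

theorem natDegree_prod_one_sub_X_pow {ι : Type*} (s : Finset ι) {a : ι → ℕ}
    (ha : ∀ i ∈ s, 0 < a i) : (∏ i ∈ s, (1 - X ^ a i : ℚ[X])).natDegree = ∑ i ∈ s, a i := by
  rw [natDegree_prod _ _ fun i hi ↦ one_sub_X_pow_ne_zero (ha i hi)]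
  exact Finset.sum_congr rfl fun i _ ↦ natDegree_one_sub_X_pow (a i)

theorem coe_prod_one_sub_X_pow {ι : Type*} (s : Finset ι) (a : ι → ℕ) :
    ((∏ i ∈ s, (1 - X ^ a i : ℚ[X]) : ℚ[X]) : PowerSeries ℚ) =
      ∏ i ∈ s, (1 - PowerSeries.X ^ a i) := by
  rw [← Polynomial.coeToPowerSeries.ringHom_apply, map_prod]
  simp

/-- If every index in `s` has an index of `t` above it whose exponent is a multiple, then the product
over `s` divides the product over `t`. -/
theorem exists_prod_one_sub_X_pow_eq {ι κ : Type*} (s : Finset ι) (t : Finset κ) {a : ι → ℕ}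
    {b : κ → ℕ} (v : κ → ι) (ha : ∀ i ∈ s, 0 < a i) (hb : ∀ j ∈ t, 0 < b j)
    (hv : ∀ j ∈ t, v j ∈ s) (hdvd : ∀ j ∈ t, a (v j) ∣ b j) (hsurj : ∀ i ∈ s, ∃ j ∈ t, v j = i) :
    ∃ P : ℚ[X], ∏ j ∈ t, (1 - X ^ b j) = P * ∏ i ∈ s, (1 - X ^ a i) ∧
      P.natDegree + ∑ i ∈ s, a i = ∑ j ∈ t, b j := by
  classical
  have h : ∏ i ∈ s, (1 - X ^ a i : ℚ[X]) ∣ ∏ j ∈ t, (1 - X ^ b j) := by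
    -- Over each `i` a single factor with `v j = i` already absorbs `1 - X ^ a i`, because `a i ∣ b
    -- j`.
    rw [← Finset.prod_fiberwise_of_maps_to hv]
    refine Finset.prod_dvd_prod_of_dvd _ _ fun i hi ↦ ?_
    obtain ⟨j, hj, rfl⟩ := hsurj i hi
    exact (one_sub_X_pow_dvd (hdvd j hj)).trans
      (Finset.dvd_prod_of_mem (fun j ↦ (1 - X ^ b j : ℚ[X])) (Finset.mem_filter.mpr ⟨hj, rfl⟩))
  obtain ⟨P, hP⟩ := h
  have h0 : ∏ j ∈ t, (1 - X ^ b j : ℚ[X]) ≠ 0 :=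
    Finset.prod_ne_zero_iff.mpr fun j hj ↦ one_sub_X_pow_ne_zero (hb j hj)
  refine ⟨P, by rw [hP, mul_comm], ?_⟩
  rw [← natDegree_prod_one_sub_X_pow s ha, ← natDegree_prod_one_sub_X_pow t hb, hP,
    natDegree_mul (left_ne_zero_of_mul (hP ▸ h0)) (right_ne_zero_of_mul (hP ▸ h0)), add_comm]

end Polynomials

/-- Comparison of the exponentials of two series whose difference is a finite sum of logarithms. -/
theorem exists_polynomial_exp_subst_eq {ι κ : Type*} {f g : PowerSeries ℚ}
    (hf : PowerSeries.constantCoeff f = 0) (hg : PowerSeries.constantCoeff g = 0)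
    (s : Finset ι) (t : Finset κ) {a : ι → ℕ} {b : κ → ℕ}
    (v : κ → ι) (ha : ∀ i ∈ s, 0 < a i) (hb : ∀ j ∈ t, 0 < b j)
    (hv : ∀ j ∈ t, v j ∈ s) (hdvd : ∀ j ∈ t, a (v j) ∣ b j) (hsurj : ∀ i ∈ s, ∃ j ∈ t, v j = i)
    (h : f + ∑ i ∈ t, negLogOneSubPow (b i) = g + ∑ i ∈ s, negLogOneSubPow (a i)) :
    ∃ P : Polynomial ℚ, (PowerSeries.exp ℚ).subst f = P * (PowerSeries.exp ℚ).subst g ∧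
      P.natDegree + ∑ i ∈ s, a i = ∑ j ∈ t, b j := by
  obtain ⟨P, hP, hdeg⟩ := exists_prod_one_sub_X_pow_eq s t v ha hb hv hdvd hsurj
  refine ⟨P, ?_, hdeg⟩
  have h1 := exp_subst_mul_prod hf hg s t ha hb h
  have h2 := congrArg (fun p : Polynomial ℚ ↦ (p : PowerSeries ℚ)) hP
  simp only [Polynomial.coe_mul] at h2
  rw [coe_prod_one_sub_X_pow, coe_prod_one_sub_X_pow] at h2
  rw [h2] at h1
  have h0 : ∏ i ∈ s, (1 - PowerSeries.X ^ a i : PowerSeries ℚ) ≠ 0 := by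
    rw [← coe_prod_one_sub_X_pow, Ne, Polynomial.coe_eq_zero_iff]
    exact Finset.prod_ne_zero_iff.mpr fun j hj ↦ one_sub_X_pow_ne_zero (ha j hj)
  refine mul_right_cancel₀ h0 (h1.trans ?_)
  ring

/-! ### Rational points in terms of degrees of points -/

section PointCount

variable {k : Type} [Field k] {X : Scheme.{0}} (π : X ⟶ Spec (.of k))

theorem fromSpecResidueField_comp (x : X) :
    X.fromSpecResidueField x ≫ π = Spec.map (CommRingCat.ofHom (constToResidueField π x)) := by
  rw [← Scheme.Hom.SpecMap_residueFieldMap_fromSpecResidueField,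
    ← Scheme.Spec.map_residueFieldIso_inv_eq_fromSpecResidueField, ← Spec.map_comp, ← Spec.map_comp]
  congr 1
  have h1 : CommRingCat.ofHom (constToResidueField π x) =
      (Scheme.ΓSpecIso (.of k)).inv ≫ (Spec (.of k)).Γevaluation (π x) ≫ π.residueFieldMap x :=
    congrArg ((Scheme.ΓSpecIso (.of k)).inv ≫ ·) (Scheme.Γevaluation_naturality π x).symm
  rw [h1]
  exact congrArg (· ≫ π.residueFieldMap x)
    (Scheme.Spec.algebraMap_residueFieldIso_inv (.of k) (π x))

/-- A `K`-point is a point together with a `k`-embedding of its residue field into `K`. -/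
noncomputable def kPointsEquiv (K : Type) [Field K] [Algebra k K] :
    KPoints π K ≃ Σ x : X, {φ : X.residueField x →+* K //
      φ.comp (constToResidueField π x) = algebraMap k K} :=
  (Equiv.subtypeEquiv (p := fun x ↦ x ≫ π = Spec.map (CommRingCat.ofHom (algebraMap k K)))
    (q := fun y : Σ x : X, (X.residueField x ⟶ .of K) ↦
      y.2.hom.comp (constToResidueField π y.1) = algebraMap k K)
    (Scheme.SpecToEquivOfField K X) fun f ↦ by
      obtain ⟨y, rfl⟩ := (Scheme.SpecToEquivOfField K X).symm.surjective f
      rw [Equiv.apply_symm_apply]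
      change (Spec.map y.2 ≫ X.fromSpecResidueField y.1) ≫ π = _ ↔ _
      rw [Category.assoc, fromSpecResidueField_comp, ← Spec.map_comp, Spec.map_inj,
        CommRingCat.hom_ext_iff]
      rfl).trans <|
  { toFun y := ⟨y.1.1, y.1.2.hom, y.2⟩
    invFun y := ⟨⟨y.1, CommRingCat.ofHom y.2.1⟩, y.2.2⟩
    left_inv _ := rfl
    right_inv _ := rfl }

theorem natCard_residueField_embeddings (x : X) (K : Type) [Field K] [Finite K] [Algebra k K] :
    Nat.card {φ : X.residueField x →+* K // φ.comp (constToResidueField π x) = algebraMap k K} =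
      if pointDegree π x ∣ Module.finrank k K then pointDegree π x else 0 := by
  let _ := (constToResidueField π x).toAlgebra
  have e : {φ : X.residueField x →+* K // φ.comp (constToResidueField π x) = algebraMap k K} ≃
      (X.residueField x →ₐ[k] K) :=
    { toFun φ := ⟨φ.1, fun c ↦ RingHom.congr_fun φ.2 c⟩
      invFun φ := ⟨φ.toRingHom, RingHom.ext fun c ↦ φ.commutes c⟩
      left_inv _ := rfl
      right_inv _ := rfl }
  rw [Nat.card_congr e]
  split_ifs with h
  · exact FiniteField.natCard_algHom_of_finrank_dvd h
  · have := (not_congr (FiniteField.nonempty_algHom_iff_finrank_dvd (F := k)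
      (K := X.residueField x) (L := K))).mpr h
    rw [not_nonempty_iff] at this
    exact Nat.card_of_isEmpty

theorem numPoints_eq_sum (K : Type) [Field K] [Finite K] [Algebra k K]
    (h : {x : X | pointDegree π x ∣ Module.finrank k K}.Finite) :
    numPoints π K = ∑ x ∈ h.toFinset, pointDegree π x := by
  classical
  let F (x : X) := {φ : X.residueField x →+* K //
    φ.comp (constToResidueField π x) = algebraMap k K}
  have hF (x : X) (φ : F x) : pointDegree π x ∣ Module.finrank k K := by
    let _ := (constToResidueField π x).toAlgebra
    exact FiniteField.nonempty_algHom_iff_finrank_dvd.mp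
      ⟨(⟨φ.1, fun c ↦ RingHom.congr_fun φ.2 c⟩ : X.residueField x →ₐ[k] K)⟩
  -- Points with infinite residue extension have degree 0 by convention; positivity of `[K : k]`
  -- keeps them out of the sum.
  have hpos : 0 < Module.finrank k K := by
    have := Finite.of_injective _ (algebraMap k K).injective
    have : Module.Finite k K := Module.Finite.of_finite
    exact Module.finrank_pos
  let s := {x : X | pointDegree π x ∣ Module.finrank k K}
  have : Fintype s := h.fintype
  have hcard (x : s) : Nat.card (F x) = pointDegree π x.1 := by
    exact (natCard_residueField_embeddings π x.1 K).trans (if_pos x.2)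
  have (x : s) : Finite (F x) := Nat.finite_of_card_ne_zero (by
    rw [hcard]; exact (Nat.pos_of_dvd_of_pos x.2 hpos).ne')
  rw [numPoints, Nat.card_congr (kPointsEquiv π K),
    ← Nat.card_congr (Equiv.sigmaSubtypeEquivOfSubset F (· ∈ s) hF), Nat.card_sigma]
  rw [Finset.sum_congr rfl fun x _ ↦ hcard x]
  exact (Finset.sum_subtype h.toFinset (p := (· ∈ s)) (fun x ↦ h.mem_toFinset)
    (pointDegree π)).symm

/-- The `k`-algebra structure of the sections over an open subset. -/
noncomputable def scalarToSections (U : X.Opens) : k →+* Γ(X, U) :=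
  ((Scheme.ΓSpecIso (.of k)).inv ≫ π.appLE ⊤ U le_top).hom

theorem evaluation_scalarToSections (U : X.Opens) (x : X) (hx : x ∈ U) (c : k) :
    (X.evaluation U x hx).hom (scalarToSections π U c) = constToResidueField π x c := by
  have h : π.appLE ⊤ U le_top = π.appTop ≫ X.presheaf.map (homOfLE (le_top (a := U))).op := rfl
  rw [scalarToSections, h]
  exact evaluation_map (homOfLE (le_top (a := U))) x hx _

theorem finiteType_scalarToSections [LocallyOfFiniteType π] {U : X.Opens} (hU : IsAffineOpen U) :
    (scalarToSections π U).FiniteType := by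
  have h1 := π.finiteType_appLE (isAffineOpen_top (Spec (.of k))) hU le_top
  refine RingHom.FiniteType.comp (g := (π.appLE ⊤ U le_top).hom)
    (f := (Scheme.ΓSpecIso (.of k)).inv.hom) h1 (RingHom.FiniteType.of_surjective _ ?_)
  exact (ConcreteCategory.bijective_of_isIso (Scheme.ΓSpecIso (.of k)).inv).2

/-- Such a point gives a `k`-algebra map `Γ(X, U) → K`, which is determined by its values on
finitely many generators. Its kernel tells which basic opens contain the point, hence determines the
point, as schemes are T0. -/
theorem finite_pointDegree_dvd_of_isAffineOpen [LocallyOfFiniteType π] {U : X.Opens}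
    (hU : IsAffineOpen U) (K : Type) [Field K] [Finite K] [Algebra k K] :
    {x : X | x ∈ U ∧ pointDegree π x ∣ Module.finrank k K}.Finite := by
  let _ := (scalarToSections π U).toAlgebra
  have : Algebra.FiniteType k Γ(X, U) := finiteType_scalarToSections π hU
  obtain ⟨G, hG⟩ := this.out
  have hφ (x : {x : X | x ∈ U ∧ pointDegree π x ∣ Module.finrank k K}) :
      ∃ φ : Γ(X, U) →ₐ[k] K, ∀ f, φ f = 0 ↔ x.1 ∉ X.basicOpen f := by
    let _ := (constToResidueField π x.1).toAlgebra
    obtain ⟨φ⟩ := FiniteField.nonempty_algHom_of_finrank_dvd (F := k)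
      (K := X.residueField x.1) (L := K) x.2.2
    refine ⟨⟨φ.toRingHom.comp (X.evaluation U x.1 x.2.1).hom, fun c ↦ ?_⟩, fun f ↦ ?_⟩
    · exact (congrArg φ (evaluation_scalarToSections π U x.1 x.2.1 c)).trans (φ.commutes c)
    · rw [← X.evaluation_eq_zero_iff_notMem_basicOpen _ x.2.1]
      exact map_eq_zero φ
  choose φ hφ using hφ
  have hinj : Function.Injective fun x (g : G) ↦ φ x g := fun x y h ↦ by
    have h1 : φ x = φ y := AlgHom.ext_of_adjoin_eq_top hG fun g hg ↦ congrFun h ⟨g, hg⟩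
    have h2 (f : Γ(X, U)) : x.1 ∈ X.basicOpen f ↔ y.1 ∈ X.basicOpen f := by
      rw [← not_iff_not, ← hφ, ← hφ, h1]
    refine Subtype.ext (Inseparable.eq (inseparable_iff_forall_isOpen.mpr fun W hW ↦ ?_))
    constructor
    · intro hxW
      obtain ⟨f, hf, hxf⟩ := hU.exists_basicOpen_le (V := ⟨W, hW⟩) ⟨x.1, hxW⟩ x.2.1
      exact hf ((h2 f).mp hxf)
    · intro hyW
      obtain ⟨f, hf, hyf⟩ := hU.exists_basicOpen_le (V := ⟨W, hW⟩) ⟨y.1, hyW⟩ y.2.1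
      exact hf ((h2 f).mpr hyf)
  exact Set.finite_coe_iff.mp (Finite.of_injective _ hinj)

theorem finite_pointDegree_dvd [LocallyOfFiniteType π] [CompactSpace X] (K : Type) [Field K]
    [Finite K] [Algebra k K] : {x : X | pointDegree π x ∣ Module.finrank k K}.Finite := by
  have hU (x : X) : ∃ U : X.Opens, IsAffineOpen U ∧ x ∈ U := by
    obtain ⟨_, ⟨U, hU, rfl⟩, hxU, -⟩ :=
      X.isBasis_affineOpens.exists_subset_of_mem_open (Set.mem_univ x) isOpen_univ
    exact ⟨U, hU, hxU⟩
  choose U hU hxU using hU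
  obtain ⟨t, ht⟩ := CompactSpace.elim_nhds_subcover (fun x ↦ (U x : Set X))
    fun x ↦ (U x).isOpen.mem_nhds (hxU x)
  refine (t.finite_toSet.biUnion fun x _ ↦
    finite_pointDegree_dvd_of_isAffineOpen π (hU x) K).subset fun y hy ↦ ?_
  obtain ⟨x, hx, hyx⟩ := Set.mem_iUnion₂.mp (ht.ge (Set.mem_univ y))
  exact Set.mem_biUnion hx ⟨hyx, hy⟩

end PointCount

/-! ### Proper closed subsets of a one-dimensional space -/

section Topology

variable {X : Type*} [TopologicalSpace X]

/-- Otherwise `closure {y} ⊂ closure {x} ⊂ X` would be a strict chain of length 2. -/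
theorem eq_of_specializes_of_topologicalKrullDim_le_one [IrreducibleSpace X] [T0Space X]
    (hX : topologicalKrullDim X ≤ 1) {x y : X} (h : x ⤳ y) (hx : closure {x} ≠ Set.univ) :
    x = y := by
  by_contra hne
  let a : IrreducibleCloseds X := ⟨closure {y}, isIrreducible_singleton.closure, isClosed_closure⟩
  let b : IrreducibleCloseds X := ⟨closure {x}, isIrreducible_singleton.closure, isClosed_closure⟩
  let c : IrreducibleCloseds X :=
    ⟨Set.univ, IrreducibleSpace.isIrreducible_univ X, isClosed_univ⟩
  have hab : a < b := by
    refine lt_of_le_of_ne h.closure_subset fun hab ↦ hne ?_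
    have h1 : closure {y} = closure {x} := congrArg (fun s : IrreducibleCloseds X ↦ (s : Set X)) hab
    exact (inseparable_iff_closure_eq.mpr h1.symm).eq
  have hbc : b < c := by
    refine lt_of_le_of_ne (Set.subset_univ _) fun hbc ↦ hx ?_
    exact congrArg (fun s : IrreducibleCloseds X ↦ (s : Set X)) hbc
  let s : LTSeries (IrreducibleCloseds X) :=
    { length := 2
      toFun := ![a, b, c]
      step := fun i ↦ by
        fin_cases i
        · exact hab
        · exact hbc }
  have h1 : (s.length : WithBot ℕ∞) ≤ 1 := (Order.LTSeries.length_le_krullDim s).trans hX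
  have h2 : s.length = 2 := rfl
  rw [h2] at h1
  exact absurd h1 (by decide)

/-- Each of the finitely many irreducible pieces of `Z` has a generic point that is not dense in
`X`, so it has no proper specialization and the piece is one point. -/
theorem finite_and_isClosed_singleton_of_topologicalKrullDim_le_one [IrreducibleSpace X]
    [NoetherianSpace X] [T0Space X] [QuasiSober X] (hX : topologicalKrullDim X ≤ 1) {Z : Set X}
    (hZ : IsClosed Z) (hne : Z ≠ Set.univ) : Z.Finite ∧ ∀ z ∈ Z, IsClosed {z} := by
  obtain ⟨S, hS, hSc, hSi, rfl⟩ := NoetherianSpace.exists_finite_set_isClosed_irreducible hZ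
  have key : ∀ W ∈ S, ∀ w ∈ W, W = {w} := by
    intro W hW w hw
    obtain ⟨x, hx⟩ := QuasiSober.sober (hSi W hW) (hSc W hW)
    have h1 (z) (hz : z ∈ W) : x = z := by
      refine eq_of_specializes_of_topologicalKrullDim_le_one hX (hx.specializes hz) fun h ↦ hne ?_
      rw [hx.def] at h
      exact Set.univ_subset_iff.mp (h ▸ Set.subset_sUnion_of_mem hW)
    exact Set.eq_singleton_iff_unique_mem.mpr ⟨hw, fun z hz ↦ (h1 z hz).symm.trans (h1 w hw)⟩
  constructor
  · refine Set.Finite.sUnion hS fun W hW ↦ ?_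
    obtain ⟨w, hw⟩ := (hSi W hW).nonempty
    rw [key W hW w hw]
    exact Set.finite_singleton w
  · rintro z ⟨W, hW, hz⟩
    rw [← key W hW z hz]
    exact hSc W hW

end Topology

/-! ### Finiteness properties of projective curves -/

section Projective

variable {k : Type} [Field k]

theorem locallyOfFiniteType_projSpaceStr (n : ℕ) : LocallyOfFiniteType (projSpaceStr k n) := by
  let _ := MvPolynomial.gradedAlgebra (σ := Fin (n + 1)) (R := k)
  have : IsScalarTower k (MvPolynomial.homogeneousSubmodule (Fin (n + 1)) k 0)
      (MvPolynomial (Fin (n + 1)) k) := ⟨fun a b c ↦ smul_mul_assoc a b.1 c⟩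
  have h1 : Algebra.FiniteType (MvPolynomial.homogeneousSubmodule (Fin (n + 1)) k 0)
      (MvPolynomial (Fin (n + 1)) k) :=
    .of_restrictScalars_finiteType k _ _
  have h2 : LocallyOfFiniteType (Spec.map (CommRingCat.ofHom
      (algebraMap k (MvPolynomial.homogeneousSubmodule (Fin (n + 1)) k 0)))) := by
    rw [HasRingHomProperty.Spec_iff (P := @LocallyOfFiniteType)]
    -- The homogeneous polynomials of degree 0 are the constants.
    refine RingHom.FiniteType.of_surjective _ fun ⟨p, hp⟩ ↦ ?_
    have hp' : p ∈ MvPolynomial.homogeneousSubmodule (Fin (n + 1)) k 0 := hp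
    rw [MvPolynomial.homogeneousSubmodule_zero] at hp'
    obtain ⟨c, hc⟩ := Submodule.mem_one.mp hp'
    exact ⟨c, Subtype.ext hc⟩
  exact inferInstanceAs (LocallyOfFiniteType (Proj.toSpecZero _ ≫ Spec.map _))

theorem quasiCompact_projSpaceStr (n : ℕ) : QuasiCompact (projSpaceStr k n) := by
  let _ := MvPolynomial.gradedAlgebra (σ := Fin (n + 1)) (R := k)
  have : IsScalarTower k (MvPolynomial.homogeneousSubmodule (Fin (n + 1)) k 0)
      (MvPolynomial (Fin (n + 1)) k) := ⟨fun a b c ↦ smul_mul_assoc a b.1 c⟩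
  have h1 : Algebra.FiniteType (MvPolynomial.homogeneousSubmodule (Fin (n + 1)) k 0)
      (MvPolynomial (Fin (n + 1)) k) :=
    .of_restrictScalars_finiteType k _ _
  exact inferInstanceAs (QuasiCompact (Proj.toSpecZero _ ≫ Spec.map _))

variable {Y : Scheme.{0}} {π : Y ⟶ Spec (.of k)}

theorem IsProjectiveCurve.isIntegral (hY : IsProjectiveCurve π) : IsIntegral Y :=
  have := hY.geometricallyIntegral
  GeometricallyIntegral.isIntegral_of_subsingleton π

theorem IsProjectiveCurve.locallyOfFiniteType (hY : IsProjectiveCurve π) :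
    LocallyOfFiniteType π := by
  obtain ⟨n, i, hi, rfl⟩ := hY.projective
  have := locallyOfFiniteType_projSpaceStr (k := k) n
  infer_instance

theorem IsProjectiveCurve.quasiCompact (hY : IsProjectiveCurve π) : QuasiCompact π := by
  obtain ⟨n, i, hi, rfl⟩ := hY.projective
  have := quasiCompact_projSpaceStr (k := k) n
  infer_instance

theorem IsProjectiveCurve.isNoetherian (hY : IsProjectiveCurve π) : IsNoetherian Y :=
  have := hY.locallyOfFiniteType
  have := hY.quasiCompact
  have := LocallyOfFiniteType.isLocallyNoetherian π
  { toCompactSpace := QuasiCompact.compactSpace_of_compactSpace π }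

end Projective

/-! ### Degrees of points under a morphism -/

section Degrees

variable {k : Type} [Field k] {X Y : Scheme.{0}}

/-- Nullstellensatz: the residue field at a closed point is finite over `k`, so the degree is not
the default value 0. -/
theorem pointDegree_pos_of_isClosed (π : X ⟶ Spec (.of k)) [LocallyOfFiniteType π] {x : X}
    (hx : IsClosed {x}) : 0 < pointDegree π x := by
  have : JacobsonSpace X := LocallyOfFiniteType.jacobsonSpace π
  have := isClosed_singleton_iff_locallyOfFiniteType.mp hx
  have h : IsFinite (X.fromSpecResidueField x ≫ π) :=
    isFinite_iff_locallyOfFiniteType_of_jacobsonSpace.mpr inferInstance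
  rw [fromSpecResidueField_comp, IsFinite.SpecMap_iff] at h
  let _ := (constToResidueField π x).toAlgebra
  have : Module.Finite k (X.residueField x) := h
  exact Module.finrank_pos (R := k) (M := X.residueField x)

theorem constToResidueField_comp (u : X ⟶ Y) (π : Y ⟶ Spec (.of k)) (x : X) :
    constToResidueField (u ≫ π) x =
      (u.residueFieldMap x).hom.comp (constToResidueField π (u x)) := by
  have h := congrArg (fun f ↦ ((Scheme.ΓSpecIso (.of k)).inv ≫ π.appTop ≫ f).hom)
    (Scheme.Γevaluation_naturality u x)
  refine Eq.trans ?_ h.symm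
  rw [constToResidueField, Scheme.Hom.comp_appTop, Category.assoc]

theorem pointDegree_comp (u : X ⟶ Y) (π : Y ⟶ Spec (.of k)) (x : X) :
    pointDegree (u ≫ π) x = pointDegree π (u x) * u.residueDegree x := by
  let _ := (constToResidueField π (u x)).toAlgebra
  let _ := (u.residueFieldMap x).hom.toAlgebra
  let _ := (constToResidueField (u ≫ π) x).toAlgebra
  have : IsScalarTower k (Y.residueField (u x)) (X.residueField x) :=
    .of_algebraMap_eq' (constToResidueField_comp u π x)
  exact (Module.finrank_mul_finrank k (Y.residueField (u x)) (X.residueField x)).symm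

theorem residueFieldMap_surjective_of_residueDegree_eq_one (u : X ⟶ Y) {x : X}
    (h : u.residueDegree x = 1) : Function.Surjective (u.residueFieldMap x).hom := by
  let _ := (u.residueFieldMap x).hom.toAlgebra
  have h' : Module.finrank (Y.residueField (u x)) (X.residueField x) = 1 := h
  have := Module.finite_of_finrank_pos (h'.symm ▸ one_pos)
  exact (bijective_algebraMap_of_linearEquiv (LinearEquiv.ofFinrankEq _ _
    ((Module.finrank_self _).trans h'.symm))).2

theorem constToResidueField_surjective_of_pointDegree_eq_one (π : X ⟶ Spec (.of k)) {x : X}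
    (h : pointDegree π x = 1) : Function.Surjective (constToResidueField π x) := by
  let _ := (constToResidueField π x).toAlgebra
  have h' : Module.finrank k (X.residueField x) = 1 := h
  have := Module.finite_of_finrank_pos (h'.symm ▸ one_pos)
  exact (bijective_algebraMap_of_linearEquiv (LinearEquiv.ofFinrankEq _ _
    ((Module.finrank_self _).trans h'.symm))).2

theorem pointDegree_eq_one_of_surjective (π : X ⟶ Spec (.of k)) {x : X}
    (h : Function.Surjective (constToResidueField π x)) : pointDegree π x = 1 := by
  let _ := (constToResidueField π x).toAlgebra
  have e : k ≃ₗ[k] X.residueField x :=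
    LinearEquiv.ofBijective (Algebra.linearMap k (X.residueField x))
      ⟨(constToResidueField π x).injective, h⟩
  exact e.finrank_eq.symm.trans (Module.finrank_self k)

variable (u : X ⟶ Y) (V : Y.Opens) [IsIso (u ∣_ V)]

theorem residueDegree_eq_one_of_isIso_restrict {x : X} (hx : u x ∈ V) : u.residueDegree x = 1 := by
  let x' : (u ⁻¹ᵁ V).toScheme := ⟨x, hx⟩
  have h0 : IsIso ((u ⁻¹ᵁ V).ι.residueFieldMap x') := inferInstance
  have h1 := Scheme.residueFieldMap_comp (u ⁻¹ᵁ V).ι u x'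
  have h2 : IsIso (((u ⁻¹ᵁ V).ι ≫ u).residueFieldMap x') := by
    rw [← morphismRestrict_ι]
    infer_instance
  rw [h1] at h2
  have h3 : IsIso (u.residueFieldMap x) := @IsIso.of_isIso_comp_right _ _ _ _ _ _ _ h0 h2
  have h4 := ConcreteCategory.bijective_of_isIso (u.residueFieldMap x)
  let _ := (u.residueFieldMap x).hom.toAlgebra
  have e : Y.residueField (u x) ≃ₗ[Y.residueField (u x)] X.residueField x :=
    LinearEquiv.ofBijective (Algebra.linearMap _ _) h4
  exact e.finrank_eq.symm.trans (Module.finrank_self _)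

theorem existsUnique_of_isIso_restrict {y : Y} (hy : y ∈ V) : ∃! x : X, u x = y := by
  have hb : Function.Bijective (u ∣_ V) :=
    ((TopCat.isIso_iff_isHomeomorph (u ∣_ V).base).mp inferInstance).bijective
  have hval (z : (u ⁻¹ᵁ V).toScheme) : ((u ∣_ V) z).1 = u z.1 := morphismRestrict_base_coe u V z
  obtain ⟨x, hx⟩ := hb.2 ⟨y, hy⟩
  refine ⟨x.1, (hval x).symm.trans (congrArg Subtype.val hx), fun z hz ↦ ?_⟩
  have h1 : (u ∣_ V) ⟨z, show u z ∈ V from hz ▸ hy⟩ = (u ∣_ V) x := by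
    rw [hx]
    exact Subtype.ext ((hval _).trans hz)
  exact congrArg Subtype.val (hb.1 h1)

end Degrees

/-! ### Conductors of seminormal rings -/

section Seminormal

variable {R R' B : Type*} {A : Type} [CommRing R] [CommRing R'] [CommRing A] [CommRing B] [IsDomain B]
  [Algebra R R'] [Algebra R A] (p : Ideal R) [p.IsPrime] [IsLocalization.AtPrime A p]
  (p' : Ideal R') {φ : A →+* B} {β : R' →+* B}

/-- If `φ a` has the same square and the same cube as a nonzero `x`, cancelling `x ^ 2` gives `φ a =
x`. -/
theorem mem_range_of_sq_cube_mem_range (hA : IsSeminormalRing A) (hφ : Function.Injective φ)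
    {x : B} (h2 : x ^ 2 ∈ φ.range) (h3 : x ^ 3 ∈ φ.range) : x ∈ φ.range := by
  obtain ⟨b, hb⟩ := h2
  obtain ⟨c, hc⟩ := h3
  have hbc : b ^ 3 = c ^ 2 := hφ (by rw [map_pow, map_pow, hb, hc]; ring)
  obtain ⟨a, rfl, rfl⟩ := hA.exists_eq b c hbc
  rw [map_pow] at hb hc
  by_cases hx : x = 0
  · rw [hx]; exact zero_mem _
  · refine ⟨a, mul_left_cancel₀ (pow_ne_zero 2 hx) ?_⟩
    linear_combination hc - φ a * hb

/-- The elements of `R'` all of whose multiples have their image in the range of `φ`. -/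
def relativeConductor (φ : A →+* B) (β : R' →+* B) : Ideal R' where
  carrier := {x | ∀ z, β (x * z) ∈ φ.range}
  add_mem' ha hb z := by rw [add_mul, map_add]; exact add_mem (ha z) (hb z)
  zero_mem' z := by rw [zero_mul, map_zero]; exact zero_mem _
  smul_mem' r x hx z := by
    rw [smul_eq_mul, mul_comm r x, mul_assoc]; exact hx _

/-- If all powers of `y` from the second on lie in the conductor, then for every `z` the square and
the cube of `β (y * z)` lie in the range of `φ`, hence so does `β (y * z)`. -/
theorem isRadical_relativeConductor (hA : IsSeminormalRing A) (hφ : Function.Injective φ) :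
    (relativeConductor φ β).IsRadical := by
  have key (y : R') (h : ∀ m ≥ 2, y ^ m ∈ relativeConductor φ β) : y ∈ relativeConductor φ β :=
    fun z ↦ by
      refine mem_range_of_sq_cube_mem_range hA hφ ?_ ?_ <;> rw [← map_pow, mul_pow]
      · exact h 2 le_rfl _
      · exact h 3 (by norm_num) _
  rintro x ⟨n, hn⟩
  induction n using Nat.strong_induction_on with
  | _ n ih =>
    obtain _ | _ | n := n
    · rw [pow_zero] at hn
      exact (Ideal.eq_top_iff_one _).mpr hn ▸ Submodule.mem_top
    · rwa [zero_add, pow_one] at hn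
    -- Lowers the exponent from `n + 2` to `n + 1`: for `m ≥ 2` the power `x ^ ((n + 1) * m)` is a
    -- multiple of `x ^ (n + 2)`.
    · refine ih (n + 1) (by omega) (key _ fun m hm ↦ ?_)
      rw [← pow_mul]
      exact Ideal.pow_mem_of_pow_mem _ hn (by nlinarith)

include p in
-- Algebraic core. The conductor is nonzero because it contains the image of `t`, and any prime of
-- `R'` containing it and contracting into `p` must be `p'`. So after inverting `R \ p` some power
-- of `x` lies in the conductor, and since the conductor is radical, so does `x`.
theorem mem_range_of_seminormal (hA : IsSeminormalRing A) (hφ : Function.Injective φ)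
    (hcomm : ∀ r : R, β (algebraMap R R' r) = φ (algebraMap R A r))
    (huniq : ∀ q : Ideal R', q.IsPrime → q.comap (algebraMap R R') = p → q = p')
    (hdim : ∀ q : Ideal R, q.IsPrime → q ≤ p → q ≠ ⊥ → q = p)
    {t : R} (ht : t ≠ 0) (hcond : ∀ z : R', ∃ r : R, algebraMap R R' r = algebraMap R R' t * z)
    {x : R'} (hx : x ∈ p') : β x ∈ φ.range := by
  have hunit {s : R} (hs : s ∉ p) : IsUnit (algebraMap R A s) :=
    IsLocalization.map_units A (⟨s, hs⟩ : p.primeCompl)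
  -- A prime containing the conductor and disjoint from `T` would contract into `p`, hence be `p'`,
  -- yet omit `x`. So some `s * x ^ n` with `s ∉ p` lies in the conductor.
  let T : Submonoid R' := p.primeCompl.map (algebraMap R R') ⊔ Submonoid.powers x
  have hT : ¬ Disjoint (relativeConductor φ β : Set R') T := fun hdisj ↦ by
    obtain ⟨q, hq, hle, hqT⟩ := Ideal.exists_le_prime_disjoint _ T hdisj
    have h1 : q.comap (algebraMap R R') = p := by
      refine hdim _ (hq.comap _) (fun s hs ↦ ?_) fun h ↦ ht ?_
      · by_contra hsp
        exact Set.disjoint_left.mp hqT hs (Submonoid.mem_sup_left ⟨s, hsp, rfl⟩)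
      · rw [← Ideal.mem_bot, ← h]
        refine hle fun z ↦ ?_
        obtain ⟨r, hr⟩ := hcond z
        rw [← hr, hcomm]
        exact ⟨_, rfl⟩
    have h2 := huniq q hq h1
    exact Set.disjoint_left.mp hqT (h2 ▸ hx) (Submonoid.mem_sup_right (Submonoid.mem_powers x))
  obtain ⟨y, hyc, hyT⟩ := Set.not_disjoint_iff.mp hT
  obtain ⟨_, ⟨s, hs, rfl⟩, _, ⟨n, rfl⟩, rfl⟩ := Submonoid.mem_sup.mp hyT
  have hxn : x ^ n ∈ relativeConductor φ β := fun z ↦ by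
    obtain ⟨a, ha⟩ := hyc z
    obtain ⟨v, hv⟩ := (hunit hs).exists_left_inv
    refine ⟨v * a, ?_⟩
    rw [map_mul, ha, mul_assoc, map_mul β, hcomm, ← mul_assoc, ← map_mul, hv, map_one, one_mul]
  have := isRadical_relativeConductor hA hφ ⟨n, hxn⟩ 1
  rwa [mul_one] at this

end Seminormal

/-! ### The numerical inequality and its equality case -/

section Counting

/-- One element suffices: if `d c = m` the two sides agree, and if `d c ≥ 2 * m` the bound is
attained only for `m = 1`, `d c = 2`. Any further element adds a positive term. -/
theorem sum_fiber_ge {ι : Type*} (F : Finset ι) (hF : F.Nonempty) (d : ι → ℕ) {m : ℕ}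
    (hd : ∀ c ∈ F, m ∣ d c) (hpos : ∀ c ∈ F, 0 < d c) :
    (if m = 1 then 1 else 0) + m ≤ ∑ c ∈ F, (d c + if d c = 1 then 1 else 0) ∧
    ((if m = 1 then 1 else 0) + m = ∑ c ∈ F, (d c + if d c = 1 then 1 else 0) →
      ∃ c, F = {c} ∧ (d c = m ∨ (m = 1 ∧ d c = 2))) := by
  classical
  obtain ⟨c, hc⟩ := hF
  have h1 : (if m = 1 then 1 else 0) + m ≤ d c + (if d c = 1 then 1 else 0) ∧
      ((if m = 1 then 1 else 0) + m = d c + (if d c = 1 then 1 else 0) →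
        (d c = m ∨ (m = 1 ∧ d c = 2))) := by
    obtain ⟨e, he⟩ := hd c hc
    have hp := hpos c hc
    rcases Nat.lt_or_ge e 2 with h | h
    · have : e = 1 := by
        rcases Nat.eq_zero_or_pos e with h0 | h0
        · rw [h0, mul_zero] at he; omega
        · omega
      rw [this, mul_one] at he
      rw [he]
      exact ⟨by omega, fun _ ↦ Or.inl rfl⟩
    · have h2 : 2 * m ≤ d c := by rw [he]; nlinarith
      have h3 : 0 < m := Nat.pos_of_ne_zero fun h0 ↦ by rw [h0, zero_mul] at he; omega
      split_ifs <;> omega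
  have h2 : ∑ c ∈ F, (d c + if d c = 1 then 1 else 0) = (d c + if d c = 1 then 1 else 0) +
      ∑ c ∈ F.erase c, (d c + if d c = 1 then 1 else 0) := (Finset.add_sum_erase _ _ hc).symm
  refine ⟨by omega, fun h ↦ ⟨c, ?_, h1.2 (by omega)⟩⟩
  have h3 : ∑ c ∈ F.erase c, (d c + if d c = 1 then 1 else 0) = 0 := by omega
  refine Finset.eq_singleton_iff_unique_mem.mpr ⟨hc, fun c' hc' ↦ ?_⟩
  by_contra hne
  have := Finset.sum_eq_zero_iff.mp h3 c' (Finset.mem_erase.mpr ⟨hne, hc'⟩)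
  have := hpos c' hc'
  omega

variable {Y C : Type*} {u : C → Y} {dY : Y → ℕ} {dC : C → ℕ} {S : Finset Y} {T : Finset C}

/-- Away from `S` the two sums agree. -/
theorem sum_add_sum_filter_eq (hT : ∀ c, c ∈ T ↔ u c ∈ S)
    (hout : ∀ y ∉ S, ∃! c, u c = y) (hdeg : ∀ c, u c ∉ S → dC c = dY (u c)) (n : ℕ)
    (hY : {y | dY y ∣ n}.Finite) (hC : {c | dC c ∣ n}.Finite) :
    ∑ y ∈ hY.toFinset, dY y + ∑ c ∈ T, (if dC c ∣ n then dC c else 0) =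
      ∑ c ∈ hC.toFinset, dC c + ∑ y ∈ S, (if dY y ∣ n then dY y else 0) := by
  classical
  have h1 : ∑ y ∈ hY.toFinset with y ∈ S, dY y = ∑ y ∈ S, (if dY y ∣ n then dY y else 0) := by
    rw [← Finset.sum_filter]
    refine Finset.sum_congr ?_ fun _ _ ↦ rfl
    ext y
    simp [and_comm]
  have h2 : ∑ c ∈ hC.toFinset with c ∈ T, dC c = ∑ c ∈ T, (if dC c ∣ n then dC c else 0) := by
    rw [← Finset.sum_filter]
    refine Finset.sum_congr ?_ fun _ _ ↦ rfl
    ext y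
    simp [and_comm]
  have h3 : ∑ c ∈ hC.toFinset with ¬ c ∈ T, dC c = ∑ y ∈ hY.toFinset with ¬ y ∈ S, dY y := by
    refine Finset.sum_bij (fun c _ ↦ u c) ?_ ?_ ?_ ?_
    · intro c hc
      simp only [Finset.mem_filter, Set.Finite.mem_toFinset, Set.mem_ofPred_eq, hT] at hc ⊢
      rw [← hdeg c hc.2]
      exact hc
    · intro c hc c' _ h
      simp only [Finset.mem_filter, hT] at hc
      exact (hout _ hc.2).unique rfl h.symm
    · intro y hy
      simp only [Finset.mem_filter, Set.Finite.mem_toFinset, Set.mem_ofPred_eq] at hy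
      obtain ⟨c, rfl, -⟩ := hout y hy.2
      refine ⟨c, ?_, rfl⟩
      simp only [Finset.mem_filter, Set.Finite.mem_toFinset, Set.mem_ofPred_eq, hT]
      rw [hdeg c hy.2]
      exact hy
    · intro c hc
      simp only [Finset.mem_filter, hT] at hc
      exact hdeg c hc.2
  rw [← Finset.sum_filter_add_sum_filter_not hY.toFinset (· ∈ S),
    ← Finset.sum_filter_add_sum_filter_not hC.toFinset (· ∈ T), h1, h2, h3]
  ring

/-- Here `P` stands for the degree of `Z_Y / Z_C`, and `N₁`, `M₁` for the numbers of rational points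
of `Y` and `C`. The fibrewise bounds give `N₁ ≤ M₁ + P`, and `P` is at most the number of points of
degree 2. -/
theorem count_le_and_of_eq (hT : ∀ c, c ∈ T ↔ u c ∈ S)
    (hout : ∀ y ∉ S, ∃! c, u c = y) (hsurj : ∀ y ∈ S, ∃ c, u c = y)
    (hdeg : ∀ c, u c ∉ S → dC c = dY (u c))
    (hdvd : ∀ c, dY (u c) ∣ dC c) (hpos : ∀ c ∈ T, 0 < dC c) {P N₁ M₁ : ℕ}
    (hP : P + ∑ y ∈ S, dY y = ∑ c ∈ T, dC c)
    (hN : N₁ + ∑ c ∈ T, (if dC c ∣ 1 then dC c else 0) =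
      M₁ + ∑ y ∈ S, (if dY y ∣ 1 then dY y else 0))
    (h2 : {c | dC c = 2}.Finite) (hle : P ≤ h2.toFinset.card) :
    N₁ ≤ M₁ + h2.toFinset.card ∧ (N₁ = M₁ + h2.toFinset.card →
      Function.Injective u ∧ (∀ c, dC c = 2 → dY (u c) = 1) ∧
        ∀ c, dC c ≠ 2 → dC c = dY (u c)) := by
  classical
  have hmaps : ∀ c ∈ T, u c ∈ S := fun c hc ↦ (hT c).mp hc
  have hfib (y) (hy : y ∈ S) := sum_fiber_ge (T.filter (u · = y)) (by
      obtain ⟨c, rfl⟩ := hsurj y hy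
      exact ⟨c, Finset.mem_filter.mpr ⟨(hT c).mpr hy, rfl⟩⟩) dC (m := dY y)
    (fun c hc ↦ (Finset.mem_filter.mp hc).2 ▸ hdvd c)
    fun c hc ↦ hpos c (Finset.mem_filter.mp hc).1
  have hif (d : ℕ) : (if d ∣ 1 then d else 0) = if d = 1 then 1 else 0 := by
    simp only [Nat.dvd_one]
    split_ifs with h
    · exact h
    · rfl
  simp only [hif] at hN
  have hsum := Finset.sum_le_sum fun y hy ↦ (hfib y hy).1
  have hE := Finset.sum_fiberwise_of_maps_to hmaps fun c ↦ dC c + if dC c = 1 then 1 else 0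
  rw [hE, Finset.sum_add_distrib, Finset.sum_add_distrib] at hsum
  refine ⟨by omega, fun heq ↦ ?_⟩
  have hloc : ∀ y ∈ S, ∃ c, T.filter (u · = y) = {c} ∧
      (dC c = dY y ∨ (dY y = 1 ∧ dC c = 2)) := by
    intro y hy
    refine (hfib y hy).2 ?_
    refine (Finset.sum_eq_sum_iff_of_le fun y hy ↦ (hfib y hy).1).mp ?_ y hy
    rw [hE, Finset.sum_add_distrib, Finset.sum_add_distrib]
    omega
  have hmem (c) (hc : c ∈ T) : T.filter (u · = u c) = {c} ∧
      (dC c = dY (u c) ∨ (dY (u c) = 1 ∧ dC c = 2)) := by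
    obtain ⟨c', h, h'⟩ := hloc (u c) (hmaps c hc)
    have : c ∈ T.filter (u · = u c) := Finset.mem_filter.mpr ⟨hc, rfl⟩
    rw [h, Finset.mem_singleton] at this
    subst this
    exact ⟨h, h'⟩
  have hinj : Function.Injective u := by
    intro c c' h
    by_cases hc : c ∈ T
    · have : c' ∈ T.filter (u · = u c) :=
        Finset.mem_filter.mpr ⟨(hT c').mpr (h ▸ hmaps c hc), h.symm⟩
      rw [(hmem c hc).1, Finset.mem_singleton] at this
      exact this.symm
    · rw [hT] at hc
      exact (hout _ hc).unique rfl h.symm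
  have hTS : ∑ c ∈ T, dY (u c) = ∑ y ∈ S, dY y := by
    refine Finset.sum_bij (fun c _ ↦ u c) hmaps (fun c _ c' _ h ↦ hinj h) ?_ fun _ _ ↦ rfl
    intro y hy
    obtain ⟨c, rfl⟩ := hsurj y hy
    exact ⟨c, (hT c).mpr hy, rfl⟩
  -- The degree changes only from 1 to 2, so each change contributes exactly 1.
  have hχ : ∑ c ∈ T, dC c = ∑ c ∈ T, dY (u c) + (T.filter fun c ↦ dC c ≠ dY (u c)).card := by
    rw [Finset.card_filter, ← Finset.sum_add_distrib]
    refine Finset.sum_congr rfl fun c hc ↦ ?_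
    rcases (hmem c hc).2 with h | ⟨h, h'⟩
    · simp [h]
    · simp [h, h']
  have hsub : (T.filter fun c ↦ dC c ≠ dY (u c)) ⊆ h2.toFinset := fun c hc ↦ by
    obtain ⟨hc, hne⟩ := Finset.mem_filter.mp hc
    rw [Set.Finite.mem_toFinset]
    exact ((hmem c hc).2.resolve_left hne).2
  -- The number of changes is `P`, which equality forces to be the number of all points of degree 2.
  -- So every such point is glued.
  have heq2 := Finset.eq_of_subset_of_card_le hsub (by omega)
  refine ⟨hinj, fun c hc ↦ ?_, fun c hc ↦ ?_⟩
  · have : c ∈ h2.toFinset := h2.mem_toFinset.mpr hc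
    rw [← heq2, Finset.mem_filter] at this
    exact ((hmem c this.1).2.resolve_left this.2).1
  · by_cases hcT : c ∈ T
    · exact (hmem c hcT).2.resolve_right fun h ↦ hc h.2
    · exact hdeg c fun h ↦ hcT ((hT c).mpr h)

end Counting

/-! ### Rational points of the glued scheme -/

section Glued

variable {k : Type} [Field k] {X : Scheme.{0}} (π : X ⟶ Spec (.of k))

/-- The quotient map `X ⟶ X_{[q,2]}` of presheafed spaces. -/
def gluedQuotPresheafed : X.toPresheafedSpace.Hom (gluedLRS π).toPresheafedSpace where
  base := 𝟙 X.toTopCat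
  c := gluedPresheafι π

theorem isLocalHom_stalkMap_gluedQuotPresheafed (x : X) :
    IsLocalHom ((gluedQuotPresheafed π).stalkMap x).hom := by
  refine ⟨fun t ht ↦ ?_⟩
  obtain ⟨U, hx, s, rfl⟩ := (gluedPresheaf π).exists_germ_eq (x := x) t
  have h0 : ((gluedQuotPresheafed π).stalkMap x).hom ((gluedPresheaf π).germ U x hx s) =
      X.presheaf.germ U x hx s.1 :=
    ConcreteCategory.congr_hom (PresheafedSpace.stalkMap_germ (gluedQuotPresheafed π) U x hx) s
  have h1 : IsUnit (X.presheaf.germ U x hx s.1) := h0 ▸ ht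
  obtain ⟨V, i, hxV, hV⟩ := X.toRingedSpace.isUnit_res_of_isUnit_germ U s.1 x hx h1
  have h2 : IsUnit ((gluedPresheaf π).map i.op s) := isUnit_gluedSections π _ hV
  have h3 := h2.map ((gluedPresheaf π).germ V x hxV).hom
  exact (congrArg IsUnit ((gluedPresheaf π).germ_res_apply i x hxV s)).mp h3

variable [Finite k]

/-- The quotient map `X ⟶ X_{[q,2]}`. -/
def gluedQuot : X ⟶ gluedScheme π where
  toHom := gluedQuotPresheafed π
  prop := isLocalHom_stalkMap_gluedQuotPresheafed π

theorem gluedQuot_app_injective (U : (gluedScheme π).Opens) :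
    Function.Injective ((gluedQuot π).app U).hom := fun _ _ h ↦ Subtype.ext h

theorem gluedQuot_comp_gluedStr : gluedQuot π ≫ gluedStr π = π := by
  obtain ⟨ψ, h1, h2⟩ : ∃ ψ : CommRingCat.of k ⟶ Γ(gluedScheme π, ⊤),
      ψ ≫ (gluedQuot π).appTop = (Scheme.ΓSpecIso (.of k)).inv ≫ π.appTop ∧
      gluedStr π = (gluedScheme π).toSpecΓ ≫ Spec.map ψ := ⟨_, rfl, rfl⟩
  rw [h2, ← Category.assoc, Scheme.toSpecΓ_naturality, Category.assoc, ← Spec.map_comp, h1,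
    Spec.map_comp, ← Category.assoc, ← Scheme.toSpecΓ_naturality, Category.assoc]
  simp

theorem gluedQuot_residueFieldMap_mem_range {x : X} (hx : pointDegree π x = 2)
    (a : (gluedScheme π).residueField (gluedQuot π x)) :
    ((gluedQuot π).residueFieldMap x).hom a ∈ (constToResidueField π x).range := by
  obtain ⟨b, rfl⟩ := (gluedScheme π).residue_surjective _ a
  obtain ⟨U, hxU, s, rfl⟩ := (gluedScheme π).presheaf.exists_germ_eq b
  have h := Scheme.evaluation_naturality_apply (gluedQuot π) x hxU s
  exact h ▸ s.2 x hxU hx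

/-- The power `s ^ (q ^ 2 - 1)` of any section takes only the values 0 and 1 at points of degree 2,
so it is a section of the glued sheaf. -/
theorem pow_mem_range_gluedQuot_residueFieldMap {x : X} (a : X.residueField x) :
    a ^ (Nat.card k ^ 2 - 1) ∈ ((gluedQuot π).residueFieldMap x).hom.range := by
  obtain ⟨b, rfl⟩ := X.residue_surjective _ a
  obtain ⟨U, hxU, s, rfl⟩ := X.presheaf.exists_germ_eq b
  let t : Γ(gluedScheme π, U) :=
    (⟨s ^ (Nat.card k ^ 2 - 1), pow_mem_gluedSections π (U := U) s⟩ : gluedSections π U)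
  have h := Scheme.evaluation_naturality_apply (gluedQuot π) (V := U) x hxU t
  refine ⟨_, h.trans ?_⟩
  exact map_pow (X.evaluation U x hxU).hom s _

/-- Every element is a root of `X ^ (n + 1) - X`. -/
theorem finite_and_card_le_of_forall_pow_eq_one {K : Type*} [Field K] {n : ℕ} (hn : 0 < n)
    (h : ∀ a : K, a ≠ 0 → a ^ n = 1) : Finite K ∧ Nat.card K ≤ n + 1 := by
  classical
  have h0 : (Polynomial.X ^ (n + 1) - Polynomial.X : Polynomial K) ≠ 0 :=
    FiniteField.X_pow_card_sub_X_ne_zero K (by omega)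
  have hroot (a : K) : a ∈ (Polynomial.X ^ (n + 1) - Polynomial.X : Polynomial K).roots.toFinset := by
    rw [Multiset.mem_toFinset, Polynomial.mem_roots h0]
    by_cases ha : a = 0
    · simp [ha]
    · simp [pow_succ, h a ha]
  have huniv : (Set.univ : Set K) =
      ((Polynomial.X ^ (n + 1) - Polynomial.X : Polynomial K).roots.toFinset : Set K) :=
    (Set.eq_univ_of_forall hroot).symm
  constructor
  · rw [← Set.finite_univ_iff, huniv]
    exact Finset.finite_toSet _
  · rw [← Set.ncard_univ, huniv, Set.ncard_coe_finset]
    refine (Multiset.toFinset_card_le _).trans ((Polynomial.card_roots' _).trans ?_)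
    rw [FiniteField.X_pow_card_sub_X_natDegree_eq K (by omega)]

/-- If the residue field after gluing is `k`, all `(q ^ 2 - 1)`-th powers in `κ(x)` lie in `k`. This
bounds the size of `κ(x)`, so no functions with prescribed values are needed to exclude degree at
least 3. -/
theorem pointDegree_gluedStr_eq_one_iff (x : X) :
    pointDegree (gluedStr π) (gluedQuot π x) = 1 ↔
      pointDegree π x = 1 ∨ pointDegree π x = 2 := by
  have hmul := pointDegree_comp (gluedQuot π) (gluedStr π) x
  have hconst := constToResidueField_comp (gluedQuot π) (gluedStr π) x
  rw [gluedQuot_comp_gluedStr] at hmul hconst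
  constructor
  · intro h
    have hsurj := constToResidueField_surjective_of_pointDegree_eq_one _ h
    have hq : 1 < Nat.card k := Finite.one_lt_card
    obtain ⟨q, hq2⟩ : ∃ q, Nat.card k = q + 2 := ⟨Nat.card k - 2, by omega⟩
    have hpow (a : X.residueField x) (ha : a ≠ 0) :
        a ^ ((Nat.card k ^ 2 - 1) * (Nat.card k - 1)) = 1 := by
      obtain ⟨b, hb⟩ := pow_mem_range_gluedQuot_residueFieldMap π a
      obtain ⟨c, rfl⟩ := hsurj b
      have h1 : constToResidueField π x c = a ^ (Nat.card k ^ 2 - 1) := by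
        rw [hconst]; exact hb
      have hc : c ≠ 0 := fun hc ↦ pow_ne_zero _ ha (by rw [← h1, hc, map_zero])
      have := Fintype.ofFinite k
      rw [pow_mul, ← h1, ← map_pow, Nat.card_eq_fintype_card, FiniteField.pow_card_sub_one_eq_one c hc,
        map_one]
    -- So `κ(x)` has fewer than `q ^ 3` elements, which leaves only degrees 1 and 2.
    have hexp : (Nat.card k ^ 2 - 1) * (Nat.card k - 1) + 1 < Nat.card k ^ 3 ∧
        0 < (Nat.card k ^ 2 - 1) * (Nat.card k - 1) := by
      rw [hq2]
      have h1 : (q + 2) ^ 2 - 1 = q ^ 2 + 4 * q + 3 := by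
        have : (q + 2) ^ 2 = q ^ 2 + 4 * q + 3 + 1 := by ring
        omega
      rw [h1, show q + 2 - 1 = q + 1 by omega]
      constructor
      · nlinarith [sq_nonneg q]
      · positivity
    obtain ⟨hfin, hcard⟩ := finite_and_card_le_of_forall_pow_eq_one hexp.2 hpow
    let _ := (constToResidueField π x).toAlgebra
    have : Module.Finite k (X.residueField x) := .of_finite
    have hd : 0 < pointDegree π x := Module.finrank_pos (R := k) (M := X.residueField x)
    have hc : Nat.card (X.residueField x) = Nat.card k ^ pointDegree π x :=
      Module.natCard_eq_pow_finrank (K := k)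
    have : pointDegree π x < 3 := (Nat.pow_lt_pow_iff_right hq).mp (by omega)
    omega
  · rintro (h | h)
    · rw [h] at hmul
      exact Nat.eq_one_of_mul_eq_one_right hmul.symm
    · refine pointDegree_eq_one_of_surjective _ fun a ↦ ?_
      obtain ⟨c, hc⟩ := gluedQuot_residueFieldMap_mem_range π h a
      refine ⟨c, ((gluedQuot π).residueFieldMap x).hom.injective (Eq.trans ?_ hc)⟩
      rw [hconst]
      rfl

theorem finite_setOf_pointDegree_dvd {X : Scheme.{0}} (p : ℕ) [Fact p.Prime] [CharP k p]
    (π : X ⟶ Spec (.of k)) [LocallyOfFiniteType π] [CompactSpace X] (n : ℕ) [NeZero n] :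
    {x : X | pointDegree π x ∣ n}.Finite := by
  have := finite_pointDegree_dvd π (FiniteField.Extension k p n)
  rwa [FiniteField.finrank_extension] at this

theorem numPoints_gluedStr
    (h1 : {x : X | pointDegree π x ∣ 1}.Finite) (h2 : {x : X | pointDegree π x = 2}.Finite) :
    numPoints (gluedStr π) k =
      ∑ x ∈ h1.toFinset, pointDegree π x + h2.toFinset.card := by
  classical
  have hset : {x : gluedScheme π | pointDegree (gluedStr π) x ∣ Module.finrank k k} =
      {x : X | pointDegree π x ∣ 1} ∪ {x : X | pointDegree π x = 2} := by
    ext x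
    rw [Module.finrank_self]
    exact Nat.dvd_one.trans ((pointDegree_gluedStr_eq_one_iff π x).trans
      (or_congr Nat.dvd_one.symm Iff.rfl))
  have hfin : {x : gluedScheme π | pointDegree (gluedStr π) x ∣ Module.finrank k k}.Finite := by
    rw [hset]; exact h1.union h2
  rw [numPoints_eq_sum _ _ hfin]
  have hone : ∀ x ∈ hfin.toFinset, pointDegree (gluedStr π) x = 1 := fun x hx ↦ by
    have := hfin.mem_toFinset.mp hx
    rwa [Set.mem_ofPred_eq, Module.finrank_self, Nat.dvd_one] at this
  have hone' : ∀ x ∈ h1.toFinset, pointDegree π x = 1 := fun x hx ↦ by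
    have := h1.mem_toFinset.mp hx
    rwa [Set.mem_ofPred_eq, Nat.dvd_one] at this
  rw [Finset.sum_congr rfl hone, Finset.sum_congr rfl hone', ← Finset.card_eq_sum_ones,
    ← Finset.card_eq_sum_ones, ← Finset.card_union_of_disjoint]
  · refine congrArg (Finset.card (α := X)) ?_
    ext x
    exact hfin.mem_toFinset.trans ((Set.ext_iff.mp hset x).trans ((Finset.mem_union (α := X)).trans
      (or_congr h1.mem_toFinset h2.mem_toFinset)).symm)
  · rw [Finset.disjoint_left]
    intro x hx hx'
    have := hone' x hx
    have := h2.mem_toFinset.mp hx'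
    rw [Set.mem_ofPred_eq] at this
    omega

end Glued

/-! ### Local rings of `Y` inside those of `C` -/

section LocalStructure

variable {C Y : Scheme.{0}} (u : C ⟶ Y)

theorem mem_primeIdealOf_iff {X : Scheme.{0}} {U : X.Opens} (hU : IsAffineOpen U) (x : X)
    (hx : x ∈ U) (r : Γ(X, U)) : r ∈ (hU.primeIdealOf ⟨x, hx⟩).asIdeal ↔ x ∉ X.basicOpen r := by
  rw [hU.primeIdealOf_eq_map_closedPoint, X.mem_basicOpen _ _ hx]
  exact Iff.rfl

theorem primeIdealOf_surjective {X : Scheme.{0}} {U : X.Opens} (hU : IsAffineOpen U) :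
    Function.Surjective hU.primeIdealOf :=
  ((TopCat.isIso_iff_isHomeomorph hU.isoSpec.hom.base).mp inferInstance).surjective

theorem app_injective_of_surjective [IsReduced Y] (hu : Function.Surjective u) (U : Y.Opens) :
    Function.Injective (u.app U).hom := by
  rw [injective_iff_map_eq_zero]
  intro s hs
  rw [← basicOpen_eq_bot_iff, ← Opens.not_nonempty_iff_eq_bot]
  rintro ⟨y, hy⟩
  obtain ⟨c, rfl⟩ := hu y
  have h : c ∈ u ⁻¹ᵁ Y.basicOpen s := hy
  rw [Scheme.preimage_basicOpen, show u.app U s = 0 from hs, Scheme.basicOpen_zero] at h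
  exact h

theorem stalkMap_germ_apply (U : Y.Opens) (c : C) (hc : u c ∈ U) (s : Γ(Y, U)) :
    (u.stalkMap c).hom (Y.presheaf.germ U (u c) hc s) =
      C.presheaf.germ (u ⁻¹ᵁ U) c hc (u.app U s) :=
  ConcreteCategory.congr_hom (u.germ_stalkMap U c hc) s

theorem stalkMap_injective_of_surjective [IsReduced Y] [IsIntegral C]
    (hu : Function.Surjective u) (c : C) : Function.Injective (u.stalkMap c).hom := by
  rw [injective_iff_map_eq_zero]
  intro a ha
  obtain ⟨U, hU, s, rfl⟩ := Y.presheaf.exists_germ_eq a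
  rw [stalkMap_germ_apply] at ha
  have h1 : (u.app U).hom s = 0 :=
    germ_injective_of_isIntegral C c (U := u ⁻¹ᵁ U) hU (ha.trans (map_zero _).symm)
  have h2 : s = 0 := app_injective_of_surjective u hu U (h1.trans (map_zero _).symm)
  rw [h2, map_zero]

theorem isIso_app_of_isIso_restrict (V : Y.Opens) [IsIso (u ∣_ V)] {W : Y.Opens} (hW : W ≤ V) :
    IsIso (u.app W) := by
  have h : V.ι ''ᵁ (V.ι ⁻¹ᵁ W) = W := by
    rw [Scheme.Hom.image_preimage_eq_opensRange_inf, Scheme.Opens.opensRange_ι]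
    exact inf_eq_right.mpr hW
  have h1 : IsIso ((u ∣_ V).app (V.ι ⁻¹ᵁ W)) := inferInstance
  rw [morphismRestrict_app] at h1
  have h2 : IsIso (u.app (V.ι ''ᵁ (V.ι ⁻¹ᵁ W))) := by
    have hi : IsIso (C.presheaf.map
        (eqToHom (image_morphismRestrict_preimage u V (V.ι ⁻¹ᵁ W))).op) :=
      @Functor.map_isIso _ _ _ _ _ _ C.presheaf _ (isIso_op _)
    exact @IsIso.of_isIso_comp_right _ _ _ _ _ _ _ hi h1
  rwa [h] at h2

/-- The conductor is nonzero. Choose `g ≠ 0` whose basic open lies in `V`; there `u` is an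
isomorphism, so each section `z` has some `g ^ n * z` coming from `Y`. As `u` is finite, one
exponent serves all module generators. -/
theorem exists_ne_zero_mul_mem_range [IsIntegral Y] [IsIntegral C] [IsFinite u]
    (hu : Function.Surjective u) (V : Y.Opens) (hV : (V : Set Y).Nonempty) [IsIso (u ∣_ V)]
    {U : Y.Opens} (hU : IsAffineOpen U) (hne : (U : Set Y).Nonempty) :
    ∃ t : Γ(Y, U), t ≠ 0 ∧ ∀ z : Γ(C, u ⁻¹ᵁ U), ∃ r : Γ(Y, U), u.app U r = u.app U t * z := by
  obtain ⟨y, hyU, hyV⟩ := nonempty_preirreducible_inter U.isOpen V.isOpen hne hV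
  obtain ⟨g, hgV, hyg⟩ := hU.exists_basicOpen_le ⟨y, hyV⟩ hyU
  have hg : g ≠ 0 := fun h ↦ by
    rw [h, Scheme.basicOpen_zero] at hyg
    exact hyg
  have hiso := isIso_app_of_isIso_restrict u V hgV
  have hsurj := (ConcreteCategory.bijective_of_isIso (u.app (Y.basicOpen g))).2
  have := hU.isLocalization_basicOpen g
  obtain ⟨c, hc⟩ := hu y
  have : Nonempty (u ⁻¹ᵁ Y.basicOpen g) := ⟨⟨c, show u c ∈ Y.basicOpen g from hc ▸ hyg⟩⟩
  have hnat (s : Γ(Y, U)) : (C.presheaf.map (homOfLE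
      (show u ⁻¹ᵁ Y.basicOpen g ≤ u ⁻¹ᵁ U from fun _ h ↦ Y.basicOpen_le g h)).op).hom (u.app U s) =
      u.app (Y.basicOpen g) ((Y.presheaf.map (homOfLE (Y.basicOpen_le g)).op).hom s) :=
    (ConcreteCategory.congr_hom (u.naturality (homOfLE (Y.basicOpen_le g)).op) s).symm
  have hinj := map_injective_of_isIntegral C (homOfLE
      (show u ⁻¹ᵁ Y.basicOpen g ≤ u ⁻¹ᵁ U from fun _ h ↦ Y.basicOpen_le g h))
  have key (z : Γ(C, u ⁻¹ᵁ U)) : ∃ n : ℕ, ∃ r : Γ(Y, U), u.app U r = u.app U g ^ n * z := by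
    obtain ⟨w, hw⟩ := hsurj ((C.presheaf.map (homOfLE
      (show u ⁻¹ᵁ Y.basicOpen g ≤ u ⁻¹ᵁ U from fun _ h ↦ Y.basicOpen_le g h)).op).hom z)
    obtain ⟨n, r, hr⟩ := IsLocalization.Away.surj g w
    have hr' : w * (Y.presheaf.map (homOfLE (Y.basicOpen_le g)).op).hom g ^ n =
      (Y.presheaf.map (homOfLE (Y.basicOpen_le g)).op).hom r := hr
    refine ⟨n, r, hinj ?_⟩
    refine (hnat r).trans ?_
    rw [← hr', map_mul, map_pow, ← hnat]
    refine Eq.trans ?_ (map_mul (C.presheaf.map _).hom _ _).symm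
    rw [map_pow, mul_comm]
    exact congrArg (_ * ·) hw
  let _ := (u.app U).hom.toAlgebra
  have hfin : Module.Finite Γ(Y, U) Γ(C, u ⁻¹ᵁ U) := u.finite_app U hU
  obtain ⟨G, hG⟩ := hfin.fg_top
  choose n hn using key
  -- A sum of exponents, as a bound for each of them.
  let N := ∑ z ∈ G, n z
  let M : Submodule Γ(Y, U) Γ(C, u ⁻¹ᵁ U) :=
    { carrier := {z | ∃ r : Γ(Y, U), u.app U r = u.app U (g ^ N) * z}
      add_mem' := by
        rintro a b ⟨r, hr⟩ ⟨s, hs⟩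
        exact ⟨r + s, by rw [map_add, hr, hs, mul_add]⟩
      zero_mem' := ⟨0, by rw [map_zero, mul_zero]⟩
      smul_mem' := by
        rintro a b ⟨r, hr⟩
        refine ⟨a * r, ?_⟩
        rw [map_mul, hr, mul_left_comm]
        rfl }
  have hM : M = ⊤ := by
    rw [← top_le_iff, ← hG, Submodule.span_le]
    intro z hz
    obtain ⟨r, hr⟩ := hn z
    have hle : n z ≤ N := Finset.single_le_sum (f := n) (fun _ _ ↦ Nat.zero_le _) hz
    refine ⟨g ^ (N - n z) * r, ?_⟩
    rw [map_mul, hr, ← mul_assoc, ← map_pow, ← map_mul, ← pow_add, Nat.sub_add_cancel hle]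
  refine ⟨g ^ N, pow_ne_zero _ hg, fun z ↦ ?_⟩
  have : z ∈ M := hM ▸ Submodule.mem_top
  exact this

theorem eq_primeIdealOf_of_le [IsIntegral Y] (hdim : topologicalKrullDim Y ≤ 1) {U : Y.Opens}
    (hU : IsAffineOpen U) (y : U) (q : PrimeSpectrum Γ(Y, U)) (hq : q ≤ hU.primeIdealOf y)
    (hne : q.asIdeal ≠ ⊥) : q = hU.primeIdealOf y := by
  obtain ⟨x, rfl⟩ := primeIdealOf_surjective hU q
  have hsp : x.1 ⤳ y.1 := by
    have := ((PrimeSpectrum.le_iff_specializes _ _).mp hq).map hU.fromSpec.continuous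
    rwa [hU.fromSpec_primeIdealOf, hU.fromSpec_primeIdealOf] at this
  obtain ⟨r, hr, hr0⟩ := Submodule.exists_mem_ne_zero_of_ne_bot hne
  have hxr : x.1 ∉ Y.basicOpen r := (mem_primeIdealOf_iff hU x.1 x.2 r).mp hr
  have := eq_of_specializes_of_topologicalKrullDim_le_one hdim hsp fun hcl ↦ by
    refine hr0 ((basicOpen_eq_bot_iff r).mp ?_)
    rw [← Opens.not_nonempty_iff_eq_bot]
    rintro ⟨z, hz⟩
    have hxz : x.1 ⤳ z := specializes_iff_mem_closure.mpr (hcl ▸ Set.mem_univ z)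
    exact hxr (hxz.mem_open (Y.basicOpen r).isOpen hz)
  rw [Subtype.ext this]

/-- The only obstruction to descending a germ is its value at `c`. Sections vanishing at `c` descend
by `mem_range_of_seminormal`; the general case subtracts a fraction from `Y` with the same value. -/
theorem germ_mem_range_stalkMap [IsIntegral Y] [IsIntegral C] [IsFinite u]
    (hdim : topologicalKrullDim Y ≤ 1) (hu : Function.Bijective u) (V : Y.Opens)
    (hV : (V : Set Y).Nonempty) [IsIso (u ∣_ V)] (c : C)
    (hsn : IsSeminormalRing (Y.presheaf.stalk (u c)))
    {U : Y.Opens} (hU : IsAffineOpen U) (hc : u c ∈ U) (f : Γ(C, u ⁻¹ᵁ U))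
    (hf : (C.evaluation (u ⁻¹ᵁ U) c hc).hom f ∈ (u.residueFieldMap c).hom.range) :
    C.presheaf.germ (u ⁻¹ᵁ U) c hc f ∈ (u.stalkMap c).hom.range := by
  have hU' : IsAffineOpen (u ⁻¹ᵁ U) := hU.preimage u
  obtain ⟨t, ht, hcond⟩ := exists_ne_zero_mul_mem_range u hu.2 V hV hU ⟨_, hc⟩
  let _ := (u.app U).hom.toAlgebra
  let _ := Y.presheaf.algebra_section_stalk ⟨u c, hc⟩
  have hloc := hU.isLocalization_stalk ⟨u c, hc⟩
  have hcomap (x : C) (hx : u x ∈ U) :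
      (hU'.primeIdealOf ⟨x, hx⟩).comap (u.app U).hom = hU.primeIdealOf ⟨u x, hx⟩ := by
    have := IsAffineOpen.comap_primeIdealOf_appLE (f := u) U hU (u ⁻¹ᵁ U) hU' le_rfl hx
    rwa [← Scheme.Hom.app_eq_appLE] at this
  have key (x : Γ(C, u ⁻¹ᵁ U)) (hx : x ∈ (hU'.primeIdealOf ⟨c, hc⟩).asIdeal) :
      C.presheaf.germ (u ⁻¹ᵁ U) c hc x ∈ (u.stalkMap c).hom.range := by
    refine mem_range_of_seminormal (R := Γ(Y, U)) (R' := Γ(C, u ⁻¹ᵁ U))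
      (A := Y.presheaf.stalk (u c)) (B := C.presheaf.stalk c)
      (hU.primeIdealOf ⟨u c, hc⟩).asIdeal (hU'.primeIdealOf ⟨c, hc⟩).asIdeal
      (φ := (u.stalkMap c).hom) (β := (C.presheaf.germ (u ⁻¹ᵁ U) c hc).hom)
      hsn (stalkMap_injective_of_surjective u hu.2 c) (fun r ↦ ?_) ?_ ?_ ht hcond hx
    · exact (stalkMap_germ_apply u U c hc r).symm
    -- Uniqueness of the prime over that of `u c` is injectivity of `u`.
    · intro q hq hqc
      obtain ⟨x, hx⟩ := primeIdealOf_surjective hU' ⟨q, hq⟩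
      have h1 := hcomap x.1 x.2
      have h2 : hU.primeIdealOf ⟨u x.1, x.2⟩ = hU.primeIdealOf ⟨u c, hc⟩ := by
        rw [← h1]
        refine PrimeSpectrum.ext (Eq.trans ?_ hqc)
        exact congrArg (fun q ↦ q.asIdeal.comap (u.app U).hom) hx
      have h3 := congrArg hU.fromSpec h2
      rw [hU.fromSpec_primeIdealOf, hU.fromSpec_primeIdealOf] at h3
      have h4 : x = ⟨c, hc⟩ := Subtype.ext (hu.1 h3)
      rw [← h4]
      exact (congrArg PrimeSpectrum.asIdeal hx).symm
    · intro q hq hle hne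
      exact congrArg PrimeSpectrum.asIdeal
        (eq_primeIdealOf_of_le hdim hU ⟨u c, hc⟩ ⟨q, hq⟩ hle hne)
  obtain ⟨a, ha⟩ := hf
  obtain ⟨b, rfl⟩ := Y.residue_surjective _ a
  obtain ⟨⟨r, s⟩, hb⟩ := IsLocalization.surj (hU.primeIdealOf ⟨u c, hc⟩).asIdeal.primeCompl b
  have hb' : b * Y.presheaf.germ U (u c) hc s.1 = Y.presheaf.germ U (u c) hc r := hb
  have hs : IsUnit (Y.presheaf.germ U (u c) hc s.1) :=
    IsLocalization.map_units (Y.presheaf.stalk (u c)) s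
  have hev (w : Γ(Y, U)) : (u.residueFieldMap c).hom ((Y.residue (u c)).hom
      (Y.presheaf.germ U (u c) hc w)) = (C.evaluation (u ⁻¹ᵁ U) c hc).hom (u.app U w) :=
    Scheme.evaluation_naturality_apply u c hc w
  -- The value of `f` at `c` is that of `r / s`, so `s * f - r` vanishes at `c`; afterwards one
  -- divides by `s`, a unit in the stalk of `Y`.
  obtain ⟨w, hw⟩ := key (u.app U s.1 * f - u.app U r) (by
    refine (mem_primeIdealOf_iff hU' c hc _).mpr
      ((C.evaluation_eq_zero_iff_notMem_basicOpen c hc _).mp ?_)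
    refine (map_sub (C.evaluation (u ⁻¹ᵁ U) c hc).hom _ _).trans (sub_eq_zero.mpr ?_)
    refine (map_mul (C.evaluation (u ⁻¹ᵁ U) c hc).hom _ _).trans ?_
    rw [← hev, ← hev, ← hb', ← ha, map_mul, map_mul, mul_comm])
  obtain ⟨v, hv⟩ := hs.exists_left_inv
  refine ⟨v * (w + Y.presheaf.germ U (u c) hc r), ?_⟩
  have h5 : C.presheaf.germ (u ⁻¹ᵁ U) c hc (u.app U s.1 * f - u.app U r) =
      (u.stalkMap c).hom (Y.presheaf.germ U (u c) hc s.1) * C.presheaf.germ (u ⁻¹ᵁ U) c hc f -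
        (u.stalkMap c).hom (Y.presheaf.germ U (u c) hc r) := by
    rw [stalkMap_germ_apply, stalkMap_germ_apply, ← map_mul, ← map_sub]
  rw [map_mul, map_add, hw]
  refine (congrArg (fun x ↦ _ * (x + _)) h5).trans ?_
  rw [sub_add_cancel, ← mul_assoc, ← map_mul, hv, map_one, one_mul]

end LocalStructure

/-! ### Factoring `u` through the glued scheme -/

section Descent

variable {k : Type} [Field k] {C Y : Scheme.{0}} (u : C ⟶ Y) (π : Y ⟶ Spec (.of k))

theorem app_mem_gluedSections
    (h : ∀ c, pointDegree (u ≫ π) c = 2 → pointDegree π (u c) = 1) (U : Y.Opens) (s : Γ(Y, U)) :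
    (u.app U).hom s ∈ gluedSections (u ≫ π) (u ⁻¹ᵁ U) := fun c hc hd ↦ by
  obtain ⟨a, ha⟩ := constToResidueField_surjective_of_pointDegree_eq_one π (h c hd)
    ((Y.evaluation U (u c) hc).hom s)
  refine ⟨a, ?_⟩
  rw [constToResidueField_comp]
  exact (congrArg (u.residueFieldMap c).hom ha).trans
    (Scheme.evaluation_naturality_apply u c hc s)

/-- The factorization of `u` through the gluing, as a morphism of presheafed spaces. -/
noncomputable def gluedDescPresheafed
    (h : ∀ c, pointDegree (u ≫ π) c = 2 → pointDegree π (u c) = 1) :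
    (gluedLRS (u ≫ π)).toPresheafedSpace.Hom Y.toPresheafedSpace where
  base := u.base
  c :=
    { app U := CommRingCat.ofHom ((u.app U.unop).hom.codRestrict
        (gluedSections (u ≫ π) (u ⁻¹ᵁ U.unop)) (app_mem_gluedSections u π h U.unop))
      naturality U V i := by
        ext s
        exact Subtype.ext (ConcreteCategory.congr_hom (u.naturality i) s) }

theorem gluedQuotPresheafed_comp_gluedDescPresheafed
    (h : ∀ c, pointDegree (u ≫ π) c = 2 → pointDegree π (u c) = 1) (c : C) :
    (gluedDescPresheafed u π h).stalkMap c ≫ (gluedQuotPresheafed (u ≫ π)).stalkMap c =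
      u.stalkMap c :=
  (PresheafedSpace.stalkMap.comp (X := C.toPresheafedSpace)
    (gluedQuotPresheafed (u ≫ π)) (gluedDescPresheafed u π h) c).symm

variable [Finite k]

/-- The factorization of `u` through the gluing. -/
noncomputable def gluedDesc (h : ∀ c, pointDegree (u ≫ π) c = 2 → pointDegree π (u c) = 1) :
    gluedScheme (u ≫ π) ⟶ Y where
  toHom := gluedDescPresheafed u π h
  prop c := by
    have h1 : IsLocalHom (u.stalkMap c).hom := u.prop c
    have h2 : IsLocalHom (((gluedQuotPresheafed (u ≫ π)).stalkMap c).hom.comp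
        ((gluedDescPresheafed u π h).stalkMap c).hom) :=
      (congrArg (fun f ↦ IsLocalHom (CommRingCat.Hom.hom f))
        (gluedQuotPresheafed_comp_gluedDescPresheafed u π h c)).mpr h1
    exact @isLocalHom_of_comp _ _ _ _ _ _ ((gluedDescPresheafed u π h).stalkMap c).hom
      ((gluedQuotPresheafed (u ≫ π)).stalkMap c).hom h2

theorem gluedDesc_comp
    (h : ∀ c, pointDegree (u ≫ π) c = 2 → pointDegree π (u c) = 1) :
    gluedDesc u π h ≫ π = gluedStr (u ≫ π) := by
  -- The target is affine, so global sections suffice; those of the glued scheme embed into those of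
  -- `C`.
  refine ext_of_isAffine ?_
  have hm (a : Γ(Spec (.of k), ⊤)) : (gluedQuot (u ≫ π)).appTop ((gluedDesc u π h ≫ π).appTop a) =
      (gluedQuot (u ≫ π)).appTop ((gluedStr (u ≫ π)).appTop a) := by
    have h1 := congrArg Scheme.Hom.appTop (gluedQuot_comp_gluedStr (u ≫ π))
    rw [Scheme.Hom.comp_appTop] at h1
    exact (ConcreteCategory.congr_hom h1 a).symm
  ext a
  exact gluedQuot_app_injective (u ≫ π) ⊤ (hm a)

theorem stalkMap_gluedQuot_injective {X : Scheme.{0}} (π : X ⟶ Spec (.of k)) (x : X) :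
    Function.Injective ((gluedQuot π).stalkMap x).hom := by
  rw [injective_iff_map_eq_zero]
  intro a ha
  obtain ⟨U, hx, s, rfl⟩ := (gluedScheme π).presheaf.exists_germ_eq a
  rw [stalkMap_germ_apply] at ha
  have ha' : X.presheaf.germ (U : X.Opens) x hx ((gluedQuot π).app U s) =
    X.presheaf.germ (U : X.Opens) x hx 0 := ha.trans (map_zero _).symm
  obtain ⟨V, hxV, i, j, hij⟩ := X.presheaf.germ_eq x hx hx _ _ ha'
  have h0 : (gluedScheme π).presheaf.map i.op s = (gluedScheme π).presheaf.map i.op 0 :=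
    Subtype.ext (hij.trans (by rw [map_zero, map_zero]; rfl))
  refine ((gluedScheme π).presheaf.germ_res_apply i x hxV s).symm.trans
    ((congrArg _ h0).trans ?_)
  exact (congrArg _ (map_zero _)).trans (map_zero _)

/-- A finite bijection is a homeomorphism, so only stalks matter. Injectivity is inherited from `Y`
into `C`; surjectivity is `germ_mem_range_stalkMap`. -/
theorem isIso_gluedDesc [IsIntegral Y] [IsIntegral C] [IsFinite u]
    (hdim : topologicalKrullDim Y ≤ 1) (hu : Function.Bijective u) (V : Y.Opens)
    (hV : (V : Set Y).Nonempty) [IsIso (u ∣_ V)] (hsn : IsSeminormal Y)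
    (h : ∀ c, pointDegree (u ≫ π) c = 2 → pointDegree π (u c) = 1)
    (h' : ∀ c, pointDegree (u ≫ π) c ≠ 2 → u.residueDegree c = 1) :
    IsIso (gluedDesc u π h) := by
  have hhomeo : IsHomeomorph u :=
    isHomeomorph_iff_continuous_isClosedMap_bijective.mpr ⟨u.continuous, u.isClosedMap, hu⟩
  rw [isIso_iff_isIso_stalkMap]
  refine ⟨(TopCat.isIso_iff_isHomeomorph _).mpr hhomeo, fun (c : C) ↦ ?_⟩
  have hcomp (a) : ((gluedQuot (u ≫ π)).stalkMap c).hom (((gluedDesc u π h).stalkMap c).hom a) =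
      (u.stalkMap c).hom a :=
    ConcreteCategory.congr_hom (gluedQuotPresheafed_comp_gluedDescPresheafed u π h c) a
  rw [ConcreteCategory.isIso_iff_bijective]
  constructor
  · intro a b hab
    refine stalkMap_injective_of_surjective u hu.2 c ?_
    rw [← hcomp, ← hcomp]
    exact congrArg _ hab
  · intro t
    obtain ⟨(W : C.Opens), (hcW : c ∈ W), (s : gluedSections (u ≫ π) W), rfl⟩ :=
      (gluedScheme (u ≫ π)).presheaf.exists_germ_eq t
    obtain ⟨_, ⟨U, hU, rfl⟩, hcU, hUW⟩ := Y.isBasis_affineOpens.exists_subset_of_mem_open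
      (show u c ∈ u '' (W : Set C) from ⟨c, hcW, rfl⟩) (hhomeo.isOpenMap _ W.isOpen)
    have hle : u ⁻¹ᵁ U ≤ (W : C.Opens) := fun x hx ↦ by
      obtain ⟨z, hz, hzx⟩ := hUW hx
      exact hu.1 hzx ▸ hz
    let s' : Γ(C, u ⁻¹ᵁ U) := (C.presheaf.map (homOfLE hle).op).hom s.1
    have hs' : s' ∈ gluedSections (u ≫ π) (u ⁻¹ᵁ U) := map_mem_gluedSections _ _ _ s.2
    -- At a point of degree 2 the gluing condition puts the value in `k`; elsewhere residue degree 1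
    -- leaves no condition.
    obtain ⟨a, ha⟩ := germ_mem_range_stalkMap u hdim hu V hV c (hsn _) hU hcU s' (by
      by_cases hd : pointDegree (u ≫ π) c = 2
      · obtain ⟨b, hb⟩ := hs' c hcU hd
        exact ⟨constToResidueField π (u c) b,
          (RingHom.congr_fun (constToResidueField_comp u π c) b).symm.trans hb⟩
      · exact residueFieldMap_surjective_of_residueDegree_eq_one u (h' c hd) _)
    refine ⟨a, stalkMap_gluedQuot_injective (u ≫ π) c ?_⟩
    refine (hcomp a).trans (ha.trans ?_)
    have h1 := C.presheaf.germ_res_apply (homOfLE hle) c hcU s.1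
    exact h1.trans (stalkMap_germ_apply (gluedQuot (u ≫ π)) W c hcW s).symm

end Descent

/-! ### Fibres and image of a finite morphism -/

section FiniteMorphism

variable {C Y : Scheme.{0}} (u : C ⟶ Y) [IsFinite u]

theorem isClosed_singleton_of_isFinite {c : C} (hc : IsClosed {u c}) : IsClosed {c} := by
  have h := (u.isDiscrete_preimage_singleton (u c)).to_subtype
  have h1 : IsClosed (u ⁻¹' {u c}) := hc.preimage u.continuous
  have h2 : IsClosed ({⟨c, rfl⟩} : Set (u ⁻¹' {u c})) := isClosed_discrete _
  have h3 := h1.isClosedMap_subtype_val _ h2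
  rwa [Set.image_singleton] at h3

/-- The image is closed and contains the dense open `V`. -/
theorem surjective_of_isIso_restrict [IrreducibleSpace Y] (V : Y.Opens)
    (hV : (V : Set Y).Nonempty) [IsIso (u ∣_ V)] : Function.Surjective u := by
  rw [← Set.range_eq_univ, ← u.isClosedMap.isClosed_range.closure_eq]
  refine ((V.isOpen.dense hV).mono fun y hy ↦ ?_).closure_eq
  obtain ⟨x, hx, -⟩ := existsUnique_of_isIso_restrict u V hy
  exact ⟨x, hx⟩

end FiniteMorphism

/-! ### Point counts and the logarithm of the zeta function -/

section Counting

theorem numPoints_congr {k : Type} [Field k] {X Y : Scheme.{0}} {π : X ⟶ Spec (.of k)}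
    {ρ : Y ⟶ Spec (.of k)}
    (e : X ≅ Y) (h : e.hom ≫ ρ = π) (K : Type) [Field K] [Algebra k K] :
    numPoints π K = numPoints ρ K :=
  Nat.card_congr
    { toFun x := ⟨x.1 ≫ e.hom, by rw [Category.assoc, h, x.2]⟩
      invFun y := ⟨y.1 ≫ e.inv, by rw [← h, Category.assoc, e.inv_hom_id_assoc, y.2]⟩
      left_inv x := Subtype.ext (by simp)
      right_inv y := Subtype.ext (by simp) }

variable {k : Type} [Field k] [Finite k]

theorem numPoints_self_eq_sum {X : Scheme.{0}} (π : X ⟶ Spec (.of k))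
    (h : {x : X | pointDegree π x ∣ 1}.Finite) :
    numPoints π k = ∑ x ∈ h.toFinset, pointDegree π x := by
  have h' : {x : X | pointDegree π x ∣ Module.finrank k k}.Finite := by
    rwa [Module.finrank_self]
  rw [numPoints_eq_sum π k h']
  refine Finset.sum_congr ?_ fun _ _ ↦ rfl
  simp only [Module.finrank_self]

variable (p : ℕ) [Fact p.Prime] [CharP k p]

theorem numPoints_extension_eq_sum {X : Scheme.{0}} (π : X ⟶ Spec (.of k)) (n : ℕ) [NeZero n]
    (h : {x : X | pointDegree π x ∣ n}.Finite) :
    numPoints π (FiniteField.Extension k p n) = ∑ x ∈ h.toFinset, pointDegree π x := by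
  have h' : {x : X | pointDegree π x ∣ Module.finrank k (FiniteField.Extension k p n)}.Finite := by
    rwa [FiniteField.finrank_extension]
  rw [numPoints_eq_sum π _ h']
  refine Finset.sum_congr ?_ fun _ _ ↦ rfl
  simp only [FiniteField.finrank_extension]

theorem numPoints_extension_two {X : Scheme.{0}} (π : X ⟶ Spec (.of k))
    (h : {x : X | pointDegree π x ∣ 2}.Finite) (h2 : {x : X | pointDegree π x = 2}.Finite) :
    numPoints π (FiniteField.Extension k p 2) = numPoints π k + 2 * h2.toFinset.card := by
  classical
  have h1 : {x : X | pointDegree π x ∣ 1}.Finite := h.subset fun x hx ↦ dvd_trans hx (one_dvd 2)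
  have hunion : h.toFinset = h1.toFinset ∪ h2.toFinset := by
    ext x
    simp only [Set.Finite.mem_toFinset, Set.mem_ofPred_eq, Finset.mem_union, Nat.dvd_one]
    exact Nat.dvd_prime Nat.prime_two
  have hdisj : Disjoint h1.toFinset h2.toFinset := by
    rw [Finset.disjoint_left]
    intro x hx hx'
    simp only [Set.Finite.mem_toFinset, Set.mem_ofPred_eq, Nat.dvd_one] at hx hx'
    omega
  rw [numPoints_extension_eq_sum p π 2 h, numPoints_self_eq_sum π h1, hunion,
    Finset.sum_union hdisj, mul_comm 2, ← smul_eq_mul,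
    Finset.sum_eq_card_nsmul (s := h2.toFinset) fun x hx ↦ h2.mem_toFinset.mp hx]

variable {C Y : Scheme.{0}} (u : C ⟶ Y) (π : Y ⟶ Spec (.of k))

theorem logZeta_add_sum_negLogOneSubPow [LocallyOfFiniteType π] [LocallyOfFiniteType (u ≫ π)]
    [CompactSpace Y] [CompactSpace C] {S : Finset Y} {T : Finset C} (hT : ∀ c, c ∈ T ↔ u c ∈ S)
    (hout : ∀ y ∉ S, ∃! c, u c = y)
    (hdeg : ∀ c, u c ∉ S → pointDegree (u ≫ π) c = pointDegree π (u c)) :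
    logZeta p π + ∑ c ∈ T, negLogOneSubPow (pointDegree (u ≫ π) c) =
      logZeta p (u ≫ π) + ∑ y ∈ S, negLogOneSubPow (pointDegree π y) := by
  ext n
  simp only [map_add, map_sum, logZeta, negLogOneSubPow, PowerSeries.coeff_mk]
  cases n with
  | zero => simp
  | succ m =>
    have hY := finite_setOf_pointDegree_dvd p π (m + 1)
    have hC := finite_setOf_pointDegree_dvd p (u ≫ π) (m + 1)
    have h := congrArg (fun n : ℕ ↦ (n : ℚ) / ((m : ℚ) + 1))
      (sum_add_sum_filter_eq hT hout hdeg (m + 1) hY hC)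
    simp only [numPoints_extension_eq_sum p π (m + 1) hY,
      numPoints_extension_eq_sum p (u ≫ π) (m + 1) hC]
    simpa [add_div, Finset.sum_div, apply_ite (fun n : ℕ ↦ (n : ℚ)), ite_div] using h

end Counting

end SingularCurve

/-! ### The main theorem -/

theorem propositiona2 (p : ℕ) [Fact p.Prime] (k : Type) [Field k] [Finite k] [CharP k p]
    (Y C : Scheme.{0}) (π : Y ⟶ Spec (.of k)) (hY : SingularCurve.IsProjectiveCurve π)
    (hsn : SingularCurve.IsSeminormal Y)
    (u : C ⟶ Y) (hu : SingularCurve.IsNormalization u) :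
    ∃ P : Polynomial ℚ,
      SingularCurve.zeta p π = (P : PowerSeries ℚ) * SingularCurve.zeta p (u ≫ π) ∧
      (2 * (P.natDegree : ℤ) ≤
          (SingularCurve.numPoints (u ≫ π) (FiniteField.Extension k p 2) : ℤ)
            - (SingularCurve.numPoints (u ≫ π) k : ℤ) →
        SingularCurve.numPoints π k ≤
            SingularCurve.numPoints (SingularCurve.gluedStr (u ≫ π)) k ∧
          (SingularCurve.numPoints π k =
              SingularCurve.numPoints (SingularCurve.gluedStr (u ≫ π)) k ↔
            ∃ e : Y ≅ SingularCurve.gluedScheme (u ≫ π),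
              e.hom ≫ SingularCurve.gluedStr (u ≫ π) = π)) := by
  open SingularCurve in
  classical
  have := hY.isIntegral
  have := hY.locallyOfFiniteType
  have := hY.isNoetherian
  have := hu.isIntegral
  have := hu.isFinite
  have : CompactSpace C := QuasiCompact.compactSpace_of_compactSpace u
  obtain ⟨V, hV, hVu⟩ := hu.birational
  have hsurj := surjective_of_isIso_restrict u V hV
  obtain ⟨hfin, hclosed⟩ := finite_and_isClosed_singleton_of_topologicalKrullDim_le_one
    hY.dim_eq_one.le (Z := (V : Set Y)ᶜ) V.isOpen.isClosed_compl
    (fun h ↦ hV.ne_empty (Set.compl_univ_iff.mp h))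
  have hfin' : (u ⁻¹' (V : Set Y)ᶜ).Finite := u.finite_preimage hfin
  have hS (y) : y ∈ hfin.toFinset ↔ y ∉ V := hfin.mem_toFinset
  have hS' (y) : y ∉ hfin.toFinset ↔ y ∈ V := by rw [hS, not_not]
  have hT (c) : c ∈ hfin'.toFinset ↔ u c ∈ hfin.toFinset :=
    hfin'.mem_toFinset.trans hfin.mem_toFinset.symm
  have hout (y) (hy : y ∉ hfin.toFinset) : ∃! c, u c = y :=
    existsUnique_of_isIso_restrict u V ((hS' y).mp hy)
  have hres (c) (hc : u c ∉ hfin.toFinset) : u.residueDegree c = 1 :=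
    residueDegree_eq_one_of_isIso_restrict u V ((hS' _).mp hc)
  have hdeg (c) (hc : u c ∉ hfin.toFinset) : pointDegree (u ≫ π) c = pointDegree π (u c) := by
    rw [pointDegree_comp, hres c hc, mul_one]
  have hdvd (c) : pointDegree π (u c) ∣ pointDegree (u ≫ π) c := ⟨_, pointDegree_comp u π c⟩
  have hposY (y) (hy : y ∈ hfin.toFinset) : 0 < pointDegree π y :=
    pointDegree_pos_of_isClosed π (hclosed y (hfin.mem_toFinset.mp hy))
  have hposC (c) (hc : c ∈ hfin'.toFinset) : 0 < pointDegree (u ≫ π) c :=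
    pointDegree_pos_of_isClosed _ (isClosed_singleton_of_isFinite u
      (hclosed _ (hfin.mem_toFinset.mp ((hT c).mp hc))))
  obtain ⟨P, hP, hPdeg⟩ := exists_polynomial_exp_subst_eq (f := logZeta p π)
    (g := logZeta p (u ≫ π)) (by simp [logZeta]) (by simp [logZeta]) hfin.toFinset hfin'.toFinset u
    hposY hposC (fun c hc ↦ (hT c).mp hc) (fun c _ ↦ hdvd c)
    (fun y hy ↦ by
      obtain ⟨c, rfl⟩ := hsurj y
      exact ⟨c, (hT c).mpr hy, rfl⟩)
    (logZeta_add_sum_negLogOneSubPow p u π hT hout hdeg)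
  refine ⟨P, hP, fun hle ↦ ?_⟩
  have hY1 := finite_setOf_pointDegree_dvd p π 1
  have hC1 := finite_setOf_pointDegree_dvd p (u ≫ π) 1
  have hC2 := finite_setOf_pointDegree_dvd p (u ≫ π) 2
  have h2 : {c | pointDegree (u ≫ π) c = 2}.Finite := 
    hC2.subset fun c (hc : _ = 2) ↦ dvd_of_eq hc
  have hN := sum_add_sum_filter_eq hT hout hdeg 1 hY1 hC1
  rw [← numPoints_self_eq_sum π hY1, ← numPoints_self_eq_sum (u ≫ π) hC1] at hN
  -- The hypothesis becomes `2 Δ ≤ 2 B₂`, with `B₂` the number of points of degree 2 on `C`.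
  rw [numPoints_extension_two p (u ≫ π) hC2 h2] at hle
  have hglued := numPoints_gluedStr (u ≫ π) hC1 h2
  rw [← numPoints_self_eq_sum (u ≫ π) hC1] at hglued
  obtain ⟨hineq, heq⟩ := count_le_and_of_eq hT hout (fun y _ ↦ hsurj y) hdeg hdvd hposC hPdeg hN h2
    (by push_cast at hle; omega)
  rw [hglued]
  refine ⟨hineq, fun h ↦ ?_, fun ⟨e, he⟩ ↦ (numPoints_congr e he k).trans hglued⟩
  obtain ⟨hinj, hd2, hd⟩ := heq h
  -- Equal degrees give residue degree 1 only after cancelling a positive degree, known for points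
  -- of `S`; elsewhere `u` is a local isomorphism.
  have hres' (c) (hc : pointDegree (u ≫ π) c ≠ 2) : u.residueDegree c = 1 := by
    by_cases hcS : u c ∈ hfin.toFinset
    · have h1 := pointDegree_comp u π c
      rw [hd c hc] at h1
      exact Nat.eq_of_mul_eq_mul_left (hposY _ hcS) (by omega)
    · exact hres c hcS
  have := isIso_gluedDesc u π hY.dim_eq_one.le ⟨hinj, hsurj⟩ V hV hsn hd2 hres'
  refine ⟨(asIso (gluedDesc u π hd2)).symm, ?_⟩
  rw [← gluedDesc_comp u π hd2]
  exact IsIso.inv_hom_id_assoc _ _
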